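/- For a prime $p$ and a function $f:\mathbb{F}_p^n\to\mathbb{F}_p$, let $\deg_p(f)$ be the smallest total degree of a polynomial in $\mathbb{F}_p[x_1,\dots,x_n]$ that agrees with $f$ on $\mathbb{F}_p^n$. Algorithms are programs for a random-access machine whose registers and memory cells hold natural numbers. Each of the following is one step: an assignment of a constant, a copy, a read or write of a memory cell, an addition or truncated subtraction of natural numbers, an addition or multiplication in $\mathbb{F}_p$, the choice of a uniformly random element of $\mathbb{F}_p$ (independent of all earlier choices), a query of the value of $f$ at a point stored in memory, and a test whether a register is zero (for branches and loops). The input is $(n,d,p)$ together with black-box access to $f$. **Theorem.** There are a single randomized algorithm $A$ and a polynomial $q$ such that for all integers $n,d\ge 1$, every prime $p$ and every $f:\mathbb{F}_p^n\to\mathbb{F}_p$, the algorithm $A$ with input $(n,d,p)$ and black-box access to $f$ always halts within $$q(n)\cdot p^{\left\lceil \frac{d}{p-1}\right\rceil+1}$$ steps, and * if $\deg_p(f)=d$, then $A$ accepts with probability at least $99/100$; * if $\deg_p(f)<d$, then $A$ rejects with probability $1$. -/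

import Mathlib

/-! Randomized random-access machine programs over `F_p` with black-box access to a function
`f : F_p^n → F_p`, and the degree of such a function. -/

namespace LowDegree

/-- The degree `deg_p f` of a function `f : F_p^n → F_p`: the least total degree of a polynomial
in `F_p[x_1, …, x_n]` that agrees with `f` as a function (one exists, see `degP_attained`). -/
noncomputable def degP {p n : ℕ} (f : (Fin n → ZMod p) → ZMod p) : ℕ :=
  sInf {k : ℕ | ∃ P : MvPolynomial (Fin n) (ZMod p),
    (∀ x, MvPolynomial.eval x P = f x) ∧ P.totalDegree = k}

/-- The minimum in the definition of `degP` is attained. -/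
theorem degP_attained {p n : ℕ} [Fact p.Prime] (f : (Fin n → ZMod p) → ZMod p) :
    ∃ P : MvPolynomial (Fin n) (ZMod p),
      (∀ x, MvPolynomial.eval x P = f x) ∧ P.totalDegree = degP f := by
  have hne : {k : ℕ | ∃ P : MvPolynomial (Fin n) (ZMod p),
      (∀ x, MvPolynomial.eval x P = f x) ∧ P.totalDegree = k}.Nonempty := by
    have h := MvPolynomial.map_restrict_dom_evalₗ (ZMod p) (Fin n)
    have hf : f ∈ (⊤ : Submodule (ZMod p) ((Fin n → ZMod p) → ZMod p)) := trivial
    rw [← h] at hf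
    obtain ⟨P, -, hP⟩ := hf
    exact ⟨P.totalDegree, P, fun x => by rw [← hP]; rfl, rfl⟩
  exact Nat.sInf_mem hne

/-- Programs of the machine. There are registers and memory cells, all indexed by `ℕ`, all holding
natural numbers, and a finite program names finitely many registers. Below, `x y z` are names of
registers. -/
inductive Prog : Type
  /-- do nothing -/
  | skip : Prog
  /-- `x := c`, with `c` a constant written in the program -/
  | const (x c : ℕ) : Prog
  /-- `x := y` -/
  | copy (x y : ℕ) : Prog
  /-- `x := y + z` in `ℕ` -/
  | add (x y z : ℕ) : Prog
  /-- `x := max (y - z) 0` -/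
  | sub (x y z : ℕ) : Prog
  /-- `x := y + z` in `F_p` -/
  | fadd (x y z : ℕ) : Prog
  /-- `x := y * z` in `F_p` -/
  | fmul (x y z : ℕ) : Prog
  /-- `x := mem[y]` -/
  | load (x y : ℕ) : Prog
  /-- `mem[x] := y` -/
  | store (x y : ℕ) : Prog
  /-- `x :=` a fresh random element of `F_p` -/
  | rand (x : ℕ) : Prog
  /-- `x := f (mem[y], …, mem[y + n - 1])`, a query to the black box -/
  | query (x y : ℕ) : Prog
  /-- one program after the other -/
  | seq (A B : Prog) : Prog
  /-- run `A` if `x ≠ 0` and `B` if `x = 0` -/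
  | cond (x : ℕ) (A B : Prog) : Prog
  /-- repeat `A` as long as `x ≠ 0` -/
  | loop (x : ℕ) (A : Prog) : Prog

/-- A state of the machine: registers, memory, and the number of random elements used so far. -/
structure State : Type where
  reg : ℕ → ℕ
  mem : ℕ → ℕ
  pos : ℕ

/-- Write `v` to register `x`. -/
def State.setReg (s : State) (x v : ℕ) : State :=
  { s with reg := Function.update s.reg x v }

/-- Write `v` to memory cell `a`. -/
def State.setMem (s : State) (a v : ℕ) : State :=
  { s with mem := Function.update s.mem a v }

/-- The initial state: registers `0, 1, 2` hold `n, d, p`, everything else is `0`. -/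
def start (p n d : ℕ) : State where
  reg := fun i => if i = 0 then n else if i = 1 then d else if i = 2 then p else 0
  mem := fun _ => 0
  pos := 0

/-- `Exec f ω A s t s'`: with black box `f` and the sequence `ω` of random elements of `F_p`,
the program `A` started in state `s` halts in state `s'` after exactly `t` steps. Every
instruction, every test of a condition and every query is one step. -/
inductive Exec {p n : ℕ} (f : (Fin n → ZMod p) → ZMod p) (ω : ℕ → ZMod p) :
    Prog → State → ℕ → State → Prop
  | skip (s : State) : Exec f ω Prog.skip s 1 s
  | const (s : State) (x c : ℕ) : Exec f ω (Prog.const x c) s 1 (s.setReg x c)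
  | copy (s : State) (x y : ℕ) : Exec f ω (Prog.copy x y) s 1 (s.setReg x (s.reg y))
  | add (s : State) (x y z : ℕ) :
      Exec f ω (Prog.add x y z) s 1 (s.setReg x (s.reg y + s.reg z))
  | sub (s : State) (x y z : ℕ) :
      Exec f ω (Prog.sub x y z) s 1 (s.setReg x (s.reg y - s.reg z))
  | fadd (s : State) (x y z : ℕ) :
      Exec f ω (Prog.fadd x y z) s 1 (s.setReg x ((s.reg y + s.reg z) % p))
  | fmul (s : State) (x y z : ℕ) :
      Exec f ω (Prog.fmul x y z) s 1 (s.setReg x ((s.reg y * s.reg z) % p))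
  | load (s : State) (x y : ℕ) :
      Exec f ω (Prog.load x y) s 1 (s.setReg x (s.mem (s.reg y)))
  | store (s : State) (x y : ℕ) :
      Exec f ω (Prog.store x y) s 1 (s.setMem (s.reg x) (s.reg y))
  | rand (s : State) (x : ℕ) :
      Exec f ω (Prog.rand x) s 1 { s.setReg x (ω s.pos).val with pos := s.pos + 1 }
  | query (s : State) (x y : ℕ) :
      Exec f ω (Prog.query x y) s 1
        (s.setReg x (f fun i : Fin n => (s.mem (s.reg y + i) : ZMod p)).val)
  | seq {A B : Prog} {s s₁ s₂ : State} {t₁ t₂ : ℕ} :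
      Exec f ω A s t₁ s₁ → Exec f ω B s₁ t₂ s₂ → Exec f ω (Prog.seq A B) s (t₁ + t₂) s₂
  | condTrue {A B : Prog} {x : ℕ} {s s' : State} {t : ℕ} :
      s.reg x ≠ 0 → Exec f ω A s t s' → Exec f ω (Prog.cond x A B) s (t + 1) s'
  | condFalse {A B : Prog} {x : ℕ} {s s' : State} {t : ℕ} :
      s.reg x = 0 → Exec f ω B s t s' → Exec f ω (Prog.cond x A B) s (t + 1) s'
  | loopExit {A : Prog} {x : ℕ} {s : State} :
      s.reg x = 0 → Exec f ω (Prog.loop x A) s 1 s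
  | loopStep {A : Prog} {x : ℕ} {s s₁ s₂ : State} {t₁ t₂ : ℕ} :
      s.reg x ≠ 0 → Exec f ω A s t₁ s₁ → Exec f ω (Prog.loop x A) s₁ t₂ s₂ →
      Exec f ω (Prog.loop x A) s (t₁ + t₂ + 1) s₂

/-- The machine is deterministic once the random elements are fixed. -/
theorem Exec.unique {p n : ℕ} {f : (Fin n → ZMod p) → ZMod p} {ω : ℕ → ZMod p}
    {A : Prog} {s s₁ s₂ : State} {t₁ t₂ : ℕ}
    (h₁ : Exec f ω A s t₁ s₁) (h₂ : Exec f ω A s t₂ s₂) : t₁ = t₂ ∧ s₁ = s₂ := by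
  induction h₁ generalizing t₂ s₂ with
  | seq _ _ ihA ihB =>
    cases h₂ with
    | seq a b =>
      obtain ⟨rfl, rfl⟩ := ihA a
      obtain ⟨rfl, rfl⟩ := ihB b
      exact ⟨rfl, rfl⟩
  | condTrue hx _ ih =>
    cases h₂ with
    | condTrue _ a =>
      obtain ⟨rfl, rfl⟩ := ih a
      exact ⟨rfl, rfl⟩
    | condFalse h _ => exact absurd h hx
  | condFalse hx _ ih =>
    cases h₂ with
    | condTrue h _ => exact absurd hx h
    | condFalse _ a =>
      obtain ⟨rfl, rfl⟩ := ih a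
      exact ⟨rfl, rfl⟩
  | loopExit hx =>
    cases h₂ with
    | loopExit _ => exact ⟨rfl, rfl⟩
    | loopStep h _ _ => exact absurd hx h
  | loopStep hx _ _ ihA ihB =>
    cases h₂ with
    | loopExit h => exact absurd h hx
    | loopStep _ a b =>
      obtain ⟨rfl, rfl⟩ := ihA a
      obtain ⟨rfl, rfl⟩ := ihB b
      exact ⟨rfl, rfl⟩
  | _ => cases h₂; exact ⟨rfl, rfl⟩

/-- On input `n, d, p`, with black box `f` and random elements `ω`, the program `A` halts after at
most `T` steps. -/
def HaltsWithin {p n : ℕ} (A : Prog) (d : ℕ) (f : (Fin n → ZMod p) → ZMod p)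
    (ω : ℕ → ZMod p) (T : ℕ) : Prop :=
  ∃ t ≤ T, ∃ s : State, Exec f ω A (start p n d) t s

/-- The run halts with a nonzero number in register `0`. -/
def Accepts {p n : ℕ} (A : Prog) (d : ℕ) (f : (Fin n → ZMod p) → ZMod p)
    (ω : ℕ → ZMod p) : Prop :=
  ∃ (t : ℕ) (s : State), Exec f ω A (start p n d) t s ∧ s.reg 0 ≠ 0

/-- The run halts with `0` in register `0`. -/
def Rejects {p n : ℕ} (A : Prog) (d : ℕ) (f : (Fin n → ZMod p) → ZMod p)
    (ω : ℕ → ZMod p) : Prop :=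
  ∃ (t : ℕ) (s : State), Exec f ω A (start p n d) t s ∧ s.reg 0 = 0

/-- A finite random string, as the beginning of an infinite sequence. -/
def extend {p T : ℕ} (r : Fin T → ZMod p) : ℕ → ZMod p :=
  fun i => if h : i < T then r ⟨i, h⟩ else 0

open Classical in
/-- The probability of the event `E` when the first `T` random elements are independent and
uniform in `F_p`. For a program that halts within `T` steps, and so reads at most `T` random
elements, this is the probability of `E` over its random choices. -/
noncomputable def prob (p : ℕ) [NeZero p] (T : ℕ) (E : (ℕ → ZMod p) → Prop) : ℝ :=
  ((Finset.univ.filter fun r : Fin T → ZMod p => E (extend r)).card : ℝ) /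
    (Fintype.card (Fin T → ZMod p) : ℝ)

end LowDegree

/-!
The degree of `f` is probed on random subspaces. Let `k = ⌈d / (p - 1)⌉` and
`e = k (p - 1) - d`, so that `0 ≤ e < p - 1`. For vectors `V 0, …, V (k - 1)` in `F_p^n` the test
statistic is

  `testSum e f V = ∑_{t ∈ F_p^k} t_0 ^ e * f (∑ t_i V_i)`.

If `deg f < d`, the summand is a polynomial in `t` of degree less than `k (p - 1)`, and the sum
vanishes (`testSum_eq_zero`). If `deg f = d`, then for uniformly random `V` the sum is nonzero with
probability at least `1 / (2 p k ^ 12)` (`pow_le_ncard_testSum`). For `k ≤ n` it therefore suffices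
to repeat the test `10 p n ^ 12` times, and one test takes `p ^ k` times polynomially many steps.
For `k > n` no function has degree `d`, and the algorithm rejects.

The lower bound takes one direction at a time. Summing `t ^ e * f (x + t v)` over `t` lowers the
degree by `r = p - 1 - e`, and the top coefficients of the result are, as functions of `v`, the
derivatives of order `D - r` of the top form of `f`, of degree `D`. Let `α` be the leading exponent
of that form. The derivatives have among their leading monomials all `v ^ δ` with `δ ≤ α` and
`∑ δ_i = r`, so the footprint bound (`card_le_card_of_reducible`) gives that the number of
directions in which the top degree is lost is at most the number of `β ∈ [0, p - 1]^n` with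
`∑ min (α_i, β_i) < r` (`exists_card_bad_directions_le`). Three estimates of this number are needed.

* If `∑ α_i ≥ 2 r`, it is at most `p ^ n / 2`, by the symmetry `β ↦ p - 1 - β`.
* If `r = p - 1` and `∑ α_i = j (p - 1)`, it is at most `8 p ^ n / (j + 4)`, by comparing with the
  mean of `∏ (1 - min (α_i, β_i) / (2 (p - 1)))`.
* If `∑ α_i = r`, the complement has at least `p ^ (n - 1)` elements.

Treating the weighted direction first, the loss of a factor `p` occurs only in the last direction,
and the other factors are at least `1 / 2` and `j / (j + 12)`, whose product is polynomial in `k`.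

The program enumerates `t ∈ F_p^k` as an odometer: `t_i` is digit `i` of a counter `m < p ^ k`, and
`∑ t_i V_i` is updated along with the digits while the carry runs. A table of the powers `a ^ e` is
computed once, which costs at most `p ^ 2` steps up to a constant. Correctness and running time are
proved together, by the rules of a Hoare logic with time bounds (`Run`).
-/

/-! ### The footprint bound -/

namespace LowDegree
open Finset

/-- The monomial function `v ↦ ∏ i, v i ^ β i`. -/
def mono {p n : ℕ} (β : Fin n → ℕ) (v : Fin n → ZMod p) : ZMod p := ∏ i, v i ^ β i

/-- The exponent vectors with all entries less than `p`. -/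
def box (p n : ℕ) : Finset (Fin n → ℕ) := Fintype.piFinset fun _ => range p

/-- The number with base `p` digits `β`. On exponent vectors in `box p n` the weight is injective,
so comparing weights is an additive monomial order there. -/
def weight (p : ℕ) {n : ℕ} (β : Fin n → ℕ) : ℕ := ∑ i, β i * p ^ (i : ℕ)

theorem mem_box {p n : ℕ} {β : Fin n → ℕ} : β ∈ box p n ↔ ∀ i, β i < p := by
  simp [box]

theorem card_box (p n : ℕ) : (box p n).card = p ^ n := by
  simp [box]

theorem mono_add {p n : ℕ} (β γ : Fin n → ℕ) (v : Fin n → ZMod p) :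
    mono (β + γ) v = mono β v * mono γ v := by
  simp [mono, pow_add, prod_mul_distrib]

theorem weight_add (p : ℕ) {n : ℕ} (β γ : Fin n → ℕ) :
    weight p (β + γ) = weight p β + weight p γ := by
  simp [weight, add_mul, sum_add_distrib]

theorem weight_injOn_box (p n : ℕ) : Set.InjOn (weight p (n := n)) (box p n) := by
  intro β hβ γ hγ h
  rw [mem_coe, mem_box] at hβ hγ
  have : finFunctionFinEquiv (fun i => (⟨β i, hβ i⟩ : Fin p)) =
      finFunctionFinEquiv (fun i => (⟨γ i, hγ i⟩ : Fin p)) := by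
    ext
    simpa [finFunctionFinEquiv_apply, weight] using h
  have h2 := finFunctionFinEquiv.injective this
  funext i
  simpa using congrFun h2 i

/-- Every function on a finite set of points is a combination of monomial functions. -/
theorem span_mono_eq_top {p n : ℕ} [Fact p.Prime] (B : Finset (Fin n → ZMod p)) :
    Submodule.span (ZMod p) (Set.range fun (β : Fin n → ℕ) (v : B) => mono β v.1) = ⊤ := by
  classical
  rw [eq_top_iff]
  intro h _
  obtain ⟨P, hP, -⟩ := degP_attained (fun v : Fin n → ZMod p => if hv : v ∈ B then h ⟨v, hv⟩ else 0)
  have : h = ∑ m ∈ P.support, P.coeff m • fun v : B => mono (fun i => m i) v.1 := by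
    funext v
    have := hP v.1
    rw [MvPolynomial.eval_eq'] at this
    simp only [v.2, dite_true] at this
    simp [← this, Finset.sum_apply, mono]
  rw [this]
  exact Submodule.sum_mem _ fun m _ => Submodule.smul_mem _ _ (Submodule.subset_span ⟨_, rfl⟩)

/-- The footprint bound: if on `B` each monomial outside `S` is a combination of monomials of
smaller weight, then the monomials in `S` span the functions on `B`, so `B` has at most as many
elements as `S`. -/
theorem card_le_card_of_reducible {p n : ℕ} [hp : Fact p.Prime] (B : Finset (Fin n → ZMod p))
    (S : Finset (Fin n → ℕ))
    (H : ∀ β ∈ box p n, β ∉ S → (fun v : B => mono β v.1) ∈ Submodule.span (ZMod p)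
      ((fun (γ : Fin n → ℕ) (v : B) => mono γ v.1) '' {γ | weight p γ < weight p β})) :
    B.card ≤ S.card := by
  classical
  set M : (Fin n → ℕ) → B → ZMod p := fun γ v => mono γ v.1 with hM
  have hp2 := hp.out.two_le
  have key : ∀ w : ℕ, ∀ β, weight p β = w →
      M β ∈ Submodule.span (ZMod p) (M '' (S : Set (Fin n → ℕ))) := by
    intro w
    induction w using Nat.strong_induction_on with
    | _ w ih =>
    intro β hw
    by_cases hβ : β ∈ box p n
    · by_cases hS : β ∈ S
      · exact Submodule.subset_span ⟨β, hS, rfl⟩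
      · refine (Submodule.span_le.2 ?_) (H β hβ hS)
        rintro _ ⟨γ, hγ, rfl⟩
        exact ih _ (hw ▸ hγ) γ rfl
    · rw [mem_box] at hβ
      push Not at hβ
      obtain ⟨i, hi⟩ := hβ
      -- `v ^ p = v` lowers an exponent that is at least `p`
      let γ := Function.update β i (β i - (p - 1))
      have e : M β = M γ := by
        funext v
        simp only [hM, mono]
        refine prod_congr rfl fun j _ => ?_
        by_cases hj : j = i
        · subst hj
          have : β j = p + (β j - p) := by omega
          have h2 : β j - (p - 1) = 1 + (β j - p) := by omega
          simp only [γ, Function.update_self]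
          rw [h2, this, pow_add, ZMod.pow_card, pow_add, pow_one]
          congr 2; omega
        · simp [γ, hj]
      rw [e]
      refine ih (weight p γ) ?_ γ rfl
      rw [← hw]
      refine sum_lt_sum (fun j _ => ?_) ⟨i, mem_univ _, ?_⟩
      · refine Nat.mul_le_mul_right _ ?_
        by_cases hj : j = i
        · subst hj; simp [γ]
        · simp [γ, hj]
      · refine Nat.mul_lt_mul_of_pos_right ?_ (by positivity)
        simp only [γ, Function.update_self]
        omega
  have top : Submodule.span (ZMod p) (((S.image M : Finset _)) : Set (B → ZMod p)) = ⊤ := by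
    rw [eq_top_iff, ← span_mono_eq_top B, Submodule.span_le]
    rintro _ ⟨β, rfl⟩
    rw [coe_image]
    exact key _ β rfl
  have h1 := finrank_span_finset_le_card (R := ZMod p) (S.image M)
  rw [Set.finrank, top, finrank_top, Module.finrank_fintype_fun_eq_card, Fintype.card_coe] at h1
  exact h1.trans card_image_le

end LowDegree

/-! ### Weighted sums over lines -/

namespace LowDegree
open Finset

/-- The function given by the reduced polynomial with coefficients `c`. -/
def polyFun {p n : ℕ} (c : (Fin n → ℕ) → ZMod p) (x : Fin n → ZMod p) : ZMod p :=
  ∑ α ∈ box p n, c α * mono α x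

/-- `g` is given by a reduced polynomial, all exponents less than `p`, of total degree exactly
`D`. Unlike `degP g = D`, this excludes `g = 0` also for `D = 0`. -/
def HasTop {p n : ℕ} (g : (Fin n → ZMod p) → ZMod p) (D : ℕ) : Prop :=
  ∃ c : (Fin n → ℕ) → ZMod p, (∀ x, g x = polyFun c x) ∧
    (∀ α ∈ box p n, D < ∑ i, α i → c α = 0) ∧ ∃ α ∈ box p n, ∑ i, α i = D ∧ c α ≠ 0

/-- The weighted sum of `g` over the line through `x` in direction `v`. Up to sign this extracts
the coefficient of `t ^ (p - 1 - e)` in `g (x + t v)`, plus terms of lower degree in `x`. -/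
def lineSum {p n : ℕ} [NeZero p] (e : ℕ) (v : Fin n → ZMod p) (g : (Fin n → ZMod p) → ZMod p)
    (x : Fin n → ZMod p) : ZMod p :=
  ∑ t : ZMod p, t ^ e * g (x + t • v)

/-- The coefficients of `lineSum e v g` in terms of those of `g`. A multi-index `α` that is not
above `γ` contributes nothing, because a binomial coefficient vanishes. -/
def lineCoeff {p n : ℕ} [NeZero p] (e : ℕ) (v : Fin n → ZMod p) (c : (Fin n → ℕ) → ZMod p)
    (γ : Fin n → ℕ) : ZMod p :=
  ∑ α ∈ box p n, c α * ((∏ i, ((α i).choose (γ i) : ZMod p)) * mono (α - γ) v *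
    ∑ t : ZMod p, t ^ (e + ∑ i, (α i - γ i)))

variable {p n : ℕ} [hp : Fact p.Prime]

theorem mono_add_smul {α : Fin n → ℕ} (hα : α ∈ box p n) (x v : Fin n → ZMod p) (t : ZMod p) :
    mono α (x + t • v) = ∑ γ ∈ box p n, (∏ i, ((α i).choose (γ i) : ZMod p)) * mono γ x *
      (mono (α - γ) v * t ^ ∑ i, (α i - γ i)) := by
  rw [mem_box] at hα
  have h : ∀ i, (x i + t * v i) ^ α i = ∑ j ∈ range p, ((α i).choose j : ZMod p) * x i ^ j *
      (v i ^ (α i - j) * t ^ (α i - j)) := by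
    intro i
    rw [add_pow]
    symm
    rw [← sum_subset (range_subset_range.2 (Nat.succ_le_of_lt (hα i)))]
    · refine sum_congr rfl fun j _ => ?_
      rw [mul_pow]; ring
    · intro j _ hj
      rw [Nat.choose_eq_zero_of_lt (by simpa using hj)]
      simp
  simp only [mono, Pi.add_apply, Pi.smul_apply, smul_eq_mul, h, box]
  rw [prod_univ_sum]
  refine sum_congr rfl fun γ _ => ?_
  simp [prod_mul_distrib, prod_pow_eq_pow_sum]

theorem lineSum_polyFun (e : ℕ) (v : Fin n → ZMod p) (c : (Fin n → ℕ) → ZMod p)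
    (x : Fin n → ZMod p) : lineSum e v (polyFun c) x = polyFun (lineCoeff e v c) x := by
  simp only [lineSum, polyFun, lineCoeff, mul_sum, sum_mul]
  rw [sum_comm]
  rw [sum_comm' (s := box p n) (t := fun _ => box p n) (t' := box p n) (s' := fun _ => box p n)
    (by tauto)]
  refine sum_congr rfl fun α hα => ?_
  rw [sum_comm]
  refine sum_congr rfl fun t _ => ?_
  rw [mono_add_smul hα, mul_sum, mul_sum]
  refine sum_congr rfl fun γ _ => ?_
  rw [pow_add]; ring

theorem sum_pow_pred_card : ∑ t : ZMod p, t ^ (p - 1) = -1 := by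
  have hp2 := hp.out.two_le
  have h : ∀ t : ZMod p, t ^ (p - 1) = 1 - if t = 0 then 1 else 0 := by
    intro t
    split_ifs with h
    · subst h; rw [zero_pow (by omega)]; simp
    · rw [ZMod.pow_card_sub_one_eq_one h]; simp
  simp [h]

theorem sum_pow_of_lt {m : ℕ} (h : m < p - 1) : ∑ t : ZMod p, t ^ m = 0 :=
  FiniteField.sum_pow_lt_card_sub_one (ZMod p) m (by simpa using h)

theorem prod_choose_eq_zero {α γ : Fin n → ℕ} (h : ¬ γ ≤ α) :
    ∏ i, ((α i).choose (γ i) : ZMod p) = 0 := by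
  simp only [Pi.le_def, not_forall, not_le] at h
  obtain ⟨i, hi⟩ := h
  exact prod_eq_zero (mem_univ i) (by rw [Nat.choose_eq_zero_of_lt hi]; simp)

theorem sum_tsub_of_le {α γ : Fin n → ℕ} (h : γ ≤ α) :
    ∑ i, (α i - γ i) + ∑ i, γ i = ∑ i, α i := by
  rw [← sum_add_distrib]
  exact sum_congr rfl fun i _ => Nat.sub_add_cancel (h i)

theorem lineCoeff_eq_zero {e r D : ℕ} (her : e + r = p - 1) {c : (Fin n → ℕ) → ZMod p}
    (hc : ∀ α ∈ box p n, D < ∑ i, α i → c α = 0) (v : Fin n → ZMod p) {γ : Fin n → ℕ}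
    (hγ : D < ∑ i, γ i + r) : lineCoeff e v c γ = 0 := by
  refine sum_eq_zero fun α hα => ?_
  by_cases h : γ ≤ α
  · have := sum_tsub_of_le h
    by_cases hD : D < ∑ i, α i
    · rw [hc α hα hD, zero_mul]
    · rw [sum_pow_of_lt (by omega)]; simp
  · rw [prod_choose_eq_zero h]; simp

theorem lineCoeff_top {e r D : ℕ} (her : e + r = p - 1) {c : (Fin n → ℕ) → ZMod p}
    (hc : ∀ α ∈ box p n, D < ∑ i, α i → c α = 0) (v : Fin n → ZMod p) {γ : Fin n → ℕ}
    (hγ : ∑ i, γ i + r = D) : lineCoeff e v c γ =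
      - ∑ α ∈ (box p n).filter (fun α => ∑ i, α i = D),
        c α * (∏ i, ((α i).choose (γ i) : ZMod p)) * mono (α - γ) v := by
  rw [sum_filter, ← sum_neg_distrib]
  refine sum_congr rfl fun α hα => ?_
  by_cases h : γ ≤ α
  · have := sum_tsub_of_le h
    split_ifs with hD
    · rw [show e + ∑ i, (α i - γ i) = p - 1 by omega, sum_pow_pred_card]; ring
    · by_cases hD' : D < ∑ i, α i
      · rw [hc α hα hD']; simp
      · rw [sum_pow_of_lt (by omega)]; simp
  · rw [prod_choose_eq_zero h]; simp

theorem exists_le_sum_eq {m : Fin n → ℕ} {r : ℕ} (h : r ≤ ∑ i, m i) :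
    ∃ δ : Fin n → ℕ, δ ≤ m ∧ ∑ i, δ i = r := by
  induction r with
  | zero => exact ⟨0, fun i => Nat.zero_le _, by simp⟩
  | succ r ih =>
    obtain ⟨δ, hδ, hs⟩ := ih (by omega)
    obtain ⟨i, -, hi⟩ : ∃ i ∈ univ, δ i < m i := exists_lt_of_sum_lt (by omega)
    refine ⟨δ + Pi.single i 1, fun j => ?_, by simp [sum_add_distrib, hs]⟩
    by_cases hj : j = i
    · subst hj; simpa using hi
    · simpa [hj] using hδ j

theorem prod_choose_ne_zero {α γ : Fin n → ℕ} (hα : α ∈ box p n) (h : γ ≤ α) :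
    ∏ i, ((α i).choose (γ i) : ZMod p) ≠ 0 := by
  rw [mem_box] at hα
  rw [prod_ne_zero_iff]
  intro i _ h0
  rw [ZMod.natCast_eq_zero_iff] at h0
  have : p ∣ (α i).factorial := by
    rw [← Nat.choose_mul_factorial_mul_factorial (h i)]
    exact Dvd.dvd.mul_right (Dvd.dvd.mul_right h0 _) _
  exact absurd (hα i) (not_lt.2 ((hp.out.dvd_factorial).1 this))

/-- The directions in which the weighted line sum loses top degree are the common zeros of the
top coefficients, which are polynomials of degree `r` in the direction. If `α` is the top exponent
of `g` of largest weight, the monomials `v ^ δ` with `δ ≤ α` and `∑ δ = r` are all leading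
monomials of such coefficients, and the footprint bound applies. -/
theorem exists_card_bad_directions_le {g : (Fin n → ZMod p) → ZMod p} {e r D : ℕ}
    (her : e + r = p - 1) (hrD : r ≤ D) (hg : HasTop g D) :
    ∃ α ∈ box p n, ∑ i, α i = D ∧
      {v : Fin n → ZMod p | ¬ HasTop (lineSum e v g) (D - r)}.ncard ≤
        ((box p n).filter fun β => ∑ i, min (α i) (β i) < r).card := by
  classical
  obtain ⟨c, hgc, hc, α₀, hα₀, hs₀, hc₀⟩ := hg
  obtain ⟨α, hα, hmax⟩ := exists_max_image
    ((box p n).filter fun α => ∑ i, α i = D ∧ c α ≠ 0) (weight p)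
    ⟨α₀, mem_filter.2 ⟨hα₀, hs₀, hc₀⟩⟩
  rw [mem_filter] at hα
  obtain ⟨hα, hs, hcα⟩ := hα
  refine ⟨α, hα, hs, ?_⟩
  rw [Set.ncard_eq_toFinset_card']
  set B := {v : Fin n → ZMod p | ¬ HasTop (lineSum e v g) (D - r)}.toFinset with hB
  have hzero : ∀ v ∈ B, ∀ γ ∈ box p n, ∑ i, γ i = D - r → lineCoeff e v c γ = 0 := by
    intro v hv γ hγ hγs
    by_contra hne
    simp only [hB, Set.mem_toFinset, Set.mem_ofPred_eq] at hv
    refine hv ⟨lineCoeff e v c, fun x => ?_, fun γ _ h => ?_, γ, hγ, hγs, hne⟩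
    · rw [← lineSum_polyFun]
      simp only [lineSum, hgc]
    · exact lineCoeff_eq_zero her hc v (by omega)
  refine card_le_card_of_reducible B _ fun β hβ hβS => ?_
  simp only [mem_filter, hβ, true_and, not_lt] at hβS
  obtain ⟨δ, hδ, hδr⟩ := exists_le_sum_eq hβS
  have hδα : δ ≤ α := fun i => (hδ i).trans (min_le_left _ _)
  have hδβ : δ ≤ β := fun i => (hδ i).trans (min_le_right _ _)
  have hγα : α - δ ≤ α := fun i => Nat.sub_le _ _
  have hγbox : α - δ ∈ box p n := mem_box.2 fun i => (Nat.sub_le _ _).trans_lt (mem_box.1 hα i)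
  have hγs : ∑ i, (α - δ) i = D - r := by
    have := sum_tsub_of_le hδα
    simp only [Pi.sub_apply]; omega
  set A := (box p n).filter (fun α => ∑ i, α i = D) with hA
  have hαA : α ∈ A := mem_filter.2 ⟨hα, hs⟩
  set b : (Fin n → ℕ) → ZMod p :=
    fun α' => c α' * ∏ i, ((α' i).choose ((α - δ) i) : ZMod p) with hb
  have hbα : b α ≠ 0 := mul_ne_zero hcα (prod_choose_ne_zero hα hγα)
  have hsub : α - (α - δ) = δ := tsub_tsub_cancel_of_le hδα
  have e1 : (fun v : B => mono β v.1) = ∑ α' ∈ A.erase α,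
      (-(b α)⁻¹ * b α') • fun v : B => mono (α' - (α - δ) + (β - δ)) v.1 := by
    funext v
    have h0 := hzero v.1 v.2 _ hγbox hγs
    rw [lineCoeff_top her hc v.1 (by omega), neg_eq_zero, ← hA, ← add_sum_erase _ _ hαA, hsub]
      at h0
    have h1 : mono β v.1 = mono δ v.1 * mono (β - δ) v.1 := by
      rw [← mono_add, add_tsub_cancel_of_le hδβ]
    have h2 : mono δ v.1 = -(b α)⁻¹ * ∑ α' ∈ A.erase α, b α' * mono (α' - (α - δ)) v.1 := by
      field_simp
      linear_combination h0
    simp only [Finset.sum_apply, Pi.smul_apply, smul_eq_mul]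
    rw [h1, h2, mul_sum, sum_mul]
    refine sum_congr rfl fun α' _ => ?_
    rw [mono_add]; ring
  rw [e1]
  refine Submodule.sum_mem _ fun α' hα' => ?_
  obtain ⟨hne, hα'A⟩ := mem_erase.1 hα'
  obtain ⟨hα'box, hα's⟩ := mem_filter.1 hα'A
  by_cases hb0 : b α' = 0
  · rw [hb0]; simp
  refine Submodule.smul_mem _ _ (Submodule.subset_span ⟨_, ?_, rfl⟩)
  have hcα' : c α' ≠ 0 := left_ne_zero_of_mul hb0
  have hle : α - δ ≤ α' := by
    by_contra h
    exact hb0 (by rw [hb]; simp only; rw [prod_choose_eq_zero h, mul_zero])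
  have hlt : weight p α' < weight p α := lt_of_le_of_ne
    (hmax α' (mem_filter.2 ⟨hα'box, hα's, hcα'⟩))
    fun h => hne (weight_injOn_box p n hα'box hα h)
  have w1 := weight_add p (α' - (α - δ)) (α - δ)
  have w2 := weight_add p (α - δ) δ
  have w3 := weight_add p (β - δ) δ
  have w4 := weight_add p (α' - (α - δ)) (β - δ)
  rw [tsub_add_cancel_of_le hle] at w1
  rw [tsub_add_cancel_of_le hδα] at w2
  rw [tsub_add_cancel_of_le hδβ] at w3
  simp only [Set.mem_ofPred_eq]
  omega

end LowDegree

/-! ### Counting exponent vectors -/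

namespace LowDegree
open Finset

theorem one_sub_sum_le_prod {ι : Type*} (s : Finset ι) (x : ι → ℝ) (h0 : ∀ i ∈ s, 0 ≤ x i)
    (h1 : ∀ i ∈ s, x i ≤ 1) : 1 - ∑ i ∈ s, x i ≤ ∏ i ∈ s, (1 - x i) := by
  classical
  induction s using Finset.induction_on with
  | empty => simp
  | insert a s ha ih =>
    rw [sum_insert ha, prod_insert ha]
    have ih' := ih (fun i hi => h0 i (mem_insert_of_mem hi)) fun i hi => h1 i (mem_insert_of_mem hi)
    have ha0 := h0 a (mem_insert_self a s)
    have ha1 := h1 a (mem_insert_self a s)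
    have hs : 0 ≤ ∑ i ∈ s, x i := sum_nonneg fun i hi => h0 i (mem_insert_of_mem hi)
    nlinarith [mul_le_mul_of_nonneg_left ih' (sub_nonneg.2 ha1), mul_nonneg ha0 hs]

theorem prod_one_sub_le {ι : Type*} (s : Finset ι) (x : ι → ℝ) (h0 : ∀ i ∈ s, 0 ≤ x i)
    (h1 : ∀ i ∈ s, x i ≤ 1) : ∏ i ∈ s, (1 - x i) ≤ 1 / (1 + ∑ i ∈ s, x i) := by
  have hs : 0 ≤ ∑ i ∈ s, x i := sum_nonneg h0
  calc ∏ i ∈ s, (1 - x i) ≤ ∏ i ∈ s, Real.exp (-x i) :=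
        prod_le_prod (fun i hi => sub_nonneg.2 (h1 i hi)) fun i _ => by
          have := Real.add_one_le_exp (-x i); linarith
    _ = (Real.exp (∑ i ∈ s, x i))⁻¹ := by rw [← Real.exp_sum, sum_neg_distrib, Real.exp_neg]
    _ ≤ 1 / (1 + ∑ i ∈ s, x i) := by
        rw [one_div]
        refine inv_anti₀ (by linarith) ?_
        have := Real.add_one_le_exp (∑ i ∈ s, x i); linarith

variable {p n : ℕ}

/-- The involution `β ↦ p - 1 - β` maps exponents with a small truncation to `α` to exponents with
a large one. -/
theorem two_mul_card_min_lt_le {α : Fin n → ℕ} (hα : α ∈ box p n) {r : ℕ}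
    (hr : 2 * r ≤ ∑ i, α i) :
    2 * ((box p n).filter fun β => ∑ i, min (α i) (β i) < r).card ≤ p ^ n := by
  have h1 := card_filter_add_card_filter_not (s := box p n) fun β => ∑ i, min (α i) (β i) < r
  have h2 : ((box p n).filter fun β => ∑ i, min (α i) (β i) < r).card ≤
      ((box p n).filter fun β => ¬ ∑ i, min (α i) (β i) < r).card := by
    refine card_le_card_of_injOn (fun β i => p - 1 - β i) (fun β hβ => ?_) fun β hβ γ hγ h => ?_
    · simp only [coe_filter, Set.mem_ofPred_eq, mem_box] at hβ ⊢
      refine ⟨fun i => by have := hβ.1 i; omega, ?_⟩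
      have : ∑ i, α i ≤ ∑ i, min (α i) (β i) + ∑ i, min (α i) (p - 1 - β i) := by
        rw [← sum_add_distrib]
        refine sum_le_sum fun i _ => ?_
        have := mem_box.1 hα i
        have := hβ.1 i
        omega
      omega
    · simp only [coe_filter, Set.mem_ofPred_eq, mem_box] at hβ hγ
      funext i
      have := congrFun h i
      have := hβ.1 i
      have := hγ.1 i
      simp only at *
      omega
  rw [card_box] at h1
  omega

theorem sum_range_min {a : ℕ} (ha : a < p) :
    2 * ∑ b ∈ range p, min a b + a * (a + 1) = 2 * (a * p) := by
  obtain ⟨m, rfl⟩ := Nat.exists_eq_add_of_lt ha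
  rw [show a + m + 1 = a + (m + 1) by ring, sum_range_add]
  have h1 : ∑ b ∈ range a, min a b = ∑ b ∈ range a, b :=
    sum_congr rfl fun b hb => by have := mem_range.1 hb; omega
  have h2 : ∑ b ∈ range (m + 1), min a (a + b) = (m + 1) * a := by
    rw [sum_congr rfl fun b _ => (by omega : min a (a + b) = a)]; simp
  have h3 := sum_range_id_mul_two a
  rw [h1, h2]
  rcases a with _ | a
  · simp
  · simp only [Nat.add_sub_cancel] at h3
    nlinarith

/-- The product `∏ (1 - min (α i) (β i) / (2 (p - 1)))` is at least `1 / 2` when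
`∑ min (α i) (β i) < p - 1`, and its mean over `β` is at most `1 / (1 + j / 4)`. -/
theorem card_min_lt_mul_le (hp : 2 ≤ p) {α : Fin n → ℕ} (hα : α ∈ box p n) {j : ℕ}
    (hj : ∑ i, α i = j * (p - 1)) :
    ((box p n).filter fun β => ∑ i, min (α i) (β i) < p - 1).card * (j + 4) ≤ 8 * p ^ n := by
  obtain ⟨N, rfl⟩ : ∃ N, p = N + 1 := ⟨p - 1, by omega⟩
  simp only [Nat.add_sub_cancel] at hj ⊢
  have hN : (1 : ℝ) ≤ N := by exact_mod_cast (by omega : 1 ≤ N)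
  have hαN : ∀ i, (α i : ℝ) ≤ N := fun i => by
    exact_mod_cast Nat.lt_succ_iff.1 (mem_box.1 hα i)
  set F := (box (N + 1) n).filter fun β => ∑ i, min (α i) (β i) < N with hF
  have hpos : ∀ β : Fin n → ℕ, ∀ i, (0 : ℝ) ≤ (min (α i) (β i) : ℕ) / (2 * N) := fun β i => by
    positivity
  have hle : ∀ β : Fin n → ℕ, ∀ i, ((min (α i) (β i) : ℕ) : ℝ) / (2 * N) ≤ 1 := fun β i => by
    have h := hαN i
    have : ((min (α i) (β i) : ℕ) : ℝ) ≤ α i := by exact_mod_cast min_le_left _ _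
    rw [div_le_one (by positivity)]; linarith
  have hlow : (F.card : ℝ) * (1 / 2) ≤
      ∑ β ∈ box (N + 1) n, ∏ i, (1 - ((min (α i) (β i) : ℕ) : ℝ) / (2 * N)) := by
    calc (F.card : ℝ) * (1 / 2) = ∑ β ∈ F, (1 / 2 : ℝ) := by simp
      _ ≤ ∑ β ∈ F, ∏ i, (1 - ((min (α i) (β i) : ℕ) : ℝ) / (2 * N)) := by
        refine sum_le_sum fun β hβ => ?_
        refine le_trans ?_ (one_sub_sum_le_prod _ _ (fun i _ => hpos β i) fun i _ => hle β i)
        rw [← sum_div, ← Nat.cast_sum]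
        have : ((∑ i, min (α i) (β i) : ℕ) : ℝ) ≤ N := by
          exact_mod_cast (mem_filter.1 hβ).2.le
        have : ((∑ i, min (α i) (β i) : ℕ) : ℝ) / (2 * N) ≤ 1 / 2 := by
          rw [div_le_iff₀ (by positivity)]; linarith
        linarith
      _ ≤ _ := sum_le_sum_of_subset_of_nonneg (filter_subset _ _) fun β _ _ =>
        prod_nonneg fun i _ => sub_nonneg.2 (hle β i)
  have hup : ∑ β ∈ box (N + 1) n, ∏ i, (1 - ((min (α i) (β i) : ℕ) : ℝ) / (2 * N)) ≤
      ((N : ℝ) + 1) ^ n * (1 / (1 + j / 4)) := by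
    rw [box, ← prod_univ_sum (fun _ => range (N + 1))
      fun i b => (1 - ((min (α i) b : ℕ) : ℝ) / (2 * N))]
    calc ∏ i, ∑ b ∈ range (N + 1), (1 - ((min (α i) b : ℕ) : ℝ) / (2 * N))
        ≤ ∏ i, (((N : ℝ) + 1) * (1 - α i / (4 * N))) := by
          refine prod_le_prod (fun i _ => sum_nonneg fun b _ =>
            sub_nonneg.2 (hle (fun _ => b) i)) fun i _ => ?_
          rw [sum_sub_distrib, ← sum_div, ← Nat.cast_sum]
          have h := sum_range_min (mem_box.1 hα i)
          have h' : (2 : ℝ) * (∑ b ∈ range (N + 1), min (α i) b : ℕ) + α i * (α i + 1) =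
            2 * (α i * (N + 1)) := by exact_mod_cast h
          have hα0 : (0 : ℝ) ≤ α i := Nat.cast_nonneg _
          have h2 : ((N : ℝ) + 1) * (α i / (4 * N)) ≤
              (∑ b ∈ range (N + 1), min (α i) b : ℕ) / (2 * N) := by
            rw [mul_div_assoc', div_le_div_iff₀ (by positivity) (by positivity)]
            have : ((N : ℝ) + 1) * α i ≤ 2 * (∑ b ∈ range (N + 1), min (α i) b : ℕ) := by
              nlinarith [hαN i]
            nlinarith
          simp only [sum_const, card_range, nsmul_eq_mul, mul_one]
          push_cast at h2 ⊢
          linarith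
      _ = ((N : ℝ) + 1) ^ n * ∏ i, (1 - (α i : ℝ) / (4 * N)) := by
          rw [prod_mul_distrib]; simp
      _ ≤ _ := by
          refine mul_le_mul_of_nonneg_left ?_ (by positivity)
          refine (prod_one_sub_le _ _ (fun i _ => by positivity) fun i _ => ?_).trans_eq ?_
          · rw [div_le_one (by positivity)]; linarith [hαN i]
          · rw [← sum_div, ← Nat.cast_sum, hj]
            congr 2
            push_cast
            field_simp
  have h := hlow.trans hup
  rw [mul_one_div, mul_one_div, le_div_iff₀ (by positivity)] at h
  have h3 : (F.card : ℝ) * (j + 4) ≤ 8 * ((N : ℝ) + 1) ^ n := by linarith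
  exact_mod_cast h3

/-- Only exponents above `α` have the largest possible truncation, and there are
`∏ (p - α i) ≥ p ^ (n - 1)` of them. -/
theorem pow_le_mul_card_le_min {α : Fin n → ℕ} (hα : α ∈ box p n) {r : ℕ}
    (hr : ∑ i, α i = r) (hrp : r < p) :
    p ^ n ≤ p * ((box p n).filter fun β => ¬ ∑ i, min (α i) (β i) < r).card := by
  have hp0 : (0 : ℝ) < p := by exact_mod_cast (by omega : 0 < p)
  have h1 : ∏ i, (p - α i) ≤ ((box p n).filter fun β => ¬ ∑ i, min (α i) (β i) < r).card := by
    rw [show ∏ i, (p - α i) = (Fintype.piFinset fun i => Ico (α i) p).card by simp]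
    refine card_le_card fun β hβ => ?_
    simp only [Fintype.mem_piFinset, mem_Ico] at hβ
    refine mem_filter.2 ⟨mem_box.2 fun i => (hβ i).2, ?_⟩
    have : ∑ i, min (α i) (β i) = ∑ i, α i := sum_congr rfl fun i _ => min_eq_left (hβ i).1
    omega
  refine le_trans ?_ (Nat.mul_le_mul_left p h1)
  have h2 := one_sub_sum_le_prod univ (fun i => (α i : ℝ) / p) (fun i _ => by positivity)
    fun i _ => by
      rw [div_le_one hp0]; exact_mod_cast (mem_box.1 hα i).le
  have h3 : ∏ i, (1 - (α i : ℝ) / p) = (∏ i, (p - α i) : ℕ) / (p : ℝ) ^ n := by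
    rw [Nat.cast_prod, ← Fin.prod_const, ← prod_div_distrib]
    refine prod_congr rfl fun i _ => ?_
    rw [Nat.cast_sub (mem_box.1 hα i).le]
    field_simp
  rw [h3, ← sum_div, ← Nat.cast_sum, hr, le_div_iff₀ (by positivity)] at h2
  have h4 : (1 : ℝ) ≤ p * (1 - r / p) := by
    rw [mul_sub, mul_div_cancel₀ _ hp0.ne']
    have : (r : ℝ) + 1 ≤ p := by exact_mod_cast hrp
    linarith
  have h5 : (p : ℝ) ^ n ≤ p * (∏ i, (p - α i) : ℕ) := by
    calc (p : ℝ) ^ n ≤ p * (1 - r / p) * (p : ℝ) ^ n := le_mul_of_one_le_left (by positivity) h4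
      _ = p * ((1 - r / p) * (p : ℝ) ^ n) := by ring
      _ ≤ _ := mul_le_mul_of_nonneg_left h2 hp0.le
  exact_mod_cast h5

end LowDegree

/-! ### Sums over random subspaces -/

namespace LowDegree
open Finset

variable {p n : ℕ} [hp : Fact p.Prime]

/-- A function of degree exactly `d ≥ 1` has a reduced polynomial with a monomial of degree `d`:
reducing the exponents of a polynomial of least degree does not increase its degree. -/
theorem hasTop_degP {f : (Fin n → ZMod p) → ZMod p} (hd : 1 ≤ degP f) : HasTop f (degP f) := by
  classical
  have hp2 := hp.out.two_le
  obtain ⟨P, hP, hPd⟩ := degP_attained f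
  let red : ℕ → ℕ := fun a => if a = 0 then 0 else (a - 1) % (p - 1) + 1
  have hred_lt : ∀ a, red a < p := fun a => by
    simp only [red]
    split_ifs
    · omega
    · have := Nat.mod_lt (a - 1) (by omega : 0 < p - 1); omega
  have hred_le : ∀ a, red a ≤ a := fun a => by
    simp only [red]
    split_ifs
    · omega
    · have := Nat.mod_le (a - 1) (p - 1); omega
  have hred_pow : ∀ a (x : ZMod p), x ^ red a = x ^ a := fun a x => by
    simp only [red]
    split_ifs with h
    · rw [h]
    · by_cases hx : x = 0
      · rw [hx, zero_pow h, zero_pow (by omega)]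
      · have := Nat.mod_add_div (a - 1) (p - 1)
        conv_rhs => rw [show a = (a - 1) % (p - 1) + 1 + (p - 1) * ((a - 1) / (p - 1)) by omega]
        rw [pow_add _ (_ + 1), pow_mul, ZMod.pow_card_sub_one_eq_one hx, one_pow, mul_one]
  let R : (Fin n →₀ ℕ) → Fin n → ℕ := fun m i => red (m i)
  have hRbox : ∀ m, R m ∈ box p n := fun m => mem_box.2 fun i => hred_lt _
  let c : (Fin n → ℕ) → ZMod p := fun α => ∑ m ∈ P.support.filter fun m => R m = α, P.coeff m
  have hfc : ∀ x, f x = polyFun c x := by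
    intro x
    rw [← hP, MvPolynomial.eval_eq', polyFun]
    simp only [c, sum_mul]
    rw [← sum_fiberwise_of_maps_to (t := box p n) (g := R) fun m _ => hRbox m]
    refine sum_congr rfl fun α _ => sum_congr rfl fun m hm => ?_
    rw [← (mem_filter.1 hm).2]
    simp [mono, R, hred_pow]
  have hc : ∀ α ∈ box p n, degP f < ∑ i, α i → c α = 0 := by
    intro α _ hα
    refine sum_eq_zero fun m hm => ?_
    rw [← (mem_filter.1 hm).2] at hα
    have h1 : ∑ i, R m i ≤ ∑ i, m i := sum_le_sum fun i _ => hred_le _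
    have h2 := MvPolynomial.le_totalDegree (mem_filter.1 hm).1
    rw [Finsupp.sum_fintype _ _ fun _ => rfl] at h2
    omega
  refine ⟨c, hfc, hc, ?_⟩
  by_contra! hne
  -- otherwise the reduced polynomial has a degree below the least one
  have hlt : degP f ≤ (∑ α ∈ box p n,
      MvPolynomial.monomial (Finsupp.equivFunOnFinite.symm α) (c α)).totalDegree := by
    refine Nat.sInf_le ⟨_, fun x => ?_, rfl⟩
    rw [hfc, map_sum, polyFun]
    refine sum_congr rfl fun α _ => ?_
    rw [MvPolynomial.eval_monomial, Finsupp.prod_fintype _ _ fun _ => pow_zero _]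
    simp [mono]
  have hle : (∑ α ∈ box p n, MvPolynomial.monomial (Finsupp.equivFunOnFinite.symm α)
      (c α)).totalDegree ≤ degP f - 1 := by
    refine MvPolynomial.totalDegree_finsetSum_le fun α hα => ?_
    by_cases h0 : c α = 0
    · simp [h0]
    · rw [MvPolynomial.totalDegree_monomial _ h0, Finsupp.sum_fintype _ _ fun _ => rfl]
      have h1 := hc α hα
      have h2 := hne α hα
      simp only [Finsupp.equivFunOnFinite_symm_apply_apply]
      by_contra h3
      by_cases h4 : ∑ i, α i = degP f
      · exact h0 (h2 h4)
      · exact h0 (h1 (by omega))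
  omega

theorem HasTop.apply_zero_ne {g : (Fin n → ZMod p) → ZMod p} (hg : HasTop g 0) : g 0 ≠ 0 := by
  obtain ⟨c, hgc, -, α, hα, hs, hcα⟩ := hg
  have hα0 : α = 0 := by
    funext i
    exact (sum_eq_zero_iff.1 hs) i (mem_univ i)
  subst hα0
  rw [hgc, polyFun, sum_eq_single 0]
  · simpa [mono] using hcα
  · intro β _ hβ
    obtain ⟨i, hi⟩ := Function.ne_iff.1 hβ
    rw [mono, prod_eq_zero (mem_univ i) (by simpa using hi), mul_zero]
  · exact fun h => absurd hα h

/-- The complement of `exists_card_bad_directions_le`. -/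
theorem exists_card_good_directions {g : (Fin n → ZMod p) → ZMod p} {e r D : ℕ}
    (her : e + r = p - 1) (hrD : r ≤ D) (hg : HasTop g D) :
    ∃ α ∈ box p n, ∑ i, α i = D ∧
      p ^ n ≤ {v : Fin n → ZMod p | HasTop (lineSum e v g) (D - r)}.ncard +
        ((box p n).filter fun β => ∑ i, min (α i) (β i) < r).card := by
  obtain ⟨α, hα, hs, h⟩ := exists_card_bad_directions_le her hrD hg
  refine ⟨α, hα, hs, ?_⟩
  have := Set.ncard_add_ncard_compl {v : Fin n → ZMod p | HasTop (lineSum e v g) (D - r)}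
  rw [Nat.card_eq_fintype_card, Fintype.card_fun, Fintype.card_fin, ZMod.card] at this
  rw [← this]
  exact Nat.add_le_add_left h _

theorem pow_le_two_mul_good {g : (Fin n → ZMod p) → ZMod p} {e r D : ℕ}
    (her : e + r = p - 1) (hrD : 2 * r ≤ D) (hg : HasTop g D) :
    p ^ n ≤ 2 * {v : Fin n → ZMod p | HasTop (lineSum e v g) (D - r)}.ncard := by
  obtain ⟨α, hα, hs, h⟩ := exists_card_good_directions her (by omega) hg
  have := two_mul_card_min_lt_le hα (hs ▸ hrD)
  omega

theorem mul_pow_le_good {g : (Fin n → ZMod p) → ZMod p} {j : ℕ} (hj : 2 ≤ j)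
    (hg : HasTop g (j * (p - 1))) :
    j * p ^ n ≤ (j + 12) *
      {v : Fin n → ZMod p | HasTop (lineSum 0 v g) ((j - 1) * (p - 1))}.ncard := by
  have hle : p - 1 ≤ j * (p - 1) := Nat.le_mul_of_pos_left _ (by omega)
  obtain ⟨α, hα, hs, h⟩ := exists_card_good_directions (Nat.zero_add _) hle hg
  rw [← Nat.sub_one_mul] at h
  have h1 := card_min_lt_mul_le hp.out.two_le hα hs
  have h2 := two_mul_card_min_lt_le (r := p - 1) hα (hs ▸ Nat.mul_le_mul_right _ hj)
  set b := ((box p n).filter fun β => ∑ i, min (α i) (β i) < p - 1).card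
  set G := {v : Fin n → ZMod p | HasTop (lineSum 0 v g) ((j - 1) * (p - 1))}.ncard
  -- the bound `1 / 2` serves for `j ≤ 12`, the bound `8 / (j + 4)` for larger `j`
  have h3 : (j + 12) * b ≤ 12 * p ^ n := by
    rcases le_total j 12 with h12 | h12
    · nlinarith
    · have : 2 * (j + 12) * b ≤ 3 * (b * (j + 4)) := by nlinarith
      nlinarith
  nlinarith

theorem pow_le_mul_good {g : (Fin n → ZMod p) → ZMod p} {e r : ℕ}
    (her : e + r = p - 1) (hg : HasTop g r) :
    p ^ n ≤ p * {v : Fin n → ZMod p | HasTop (lineSum e v g) 0}.ncard := by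
  have hp2 := hp.out.two_le
  obtain ⟨α, hα, hs, h⟩ := exists_card_bad_directions_le her le_rfl hg
  have h1 := pow_le_mul_card_le_min hα hs (by omega)
  refine h1.trans (Nat.mul_le_mul_left p ?_)
  have h2 := card_filter_add_card_filter_not (s := box p n) fun β => ∑ i, min (α i) (β i) < r
  have h3 := Set.ncard_add_ncard_compl {v : Fin n → ZMod p | HasTop (lineSum e v g) 0}
  rw [Nat.card_eq_fintype_card, Fintype.card_fun, Fintype.card_fin, ZMod.card] at h3
  rw [card_box] at h2
  rw [Nat.sub_self] at h
  rw [← Set.compl_ofPred] at h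
  omega

/-- The sum of `g` over the points `∑ t i • V i`, counted with multiplicity if the `V i` are
dependent. -/
def spanSum {j : ℕ} (g : (Fin n → ZMod p) → ZMod p) (V : Fin j → Fin n → ZMod p) : ZMod p :=
  ∑ t : Fin j → ZMod p, g (∑ i, t i • V i)

/-- The sum of `f` over the points `∑ t i • V i`, weighted with `t 0 ^ e`: the test statistic. -/
def testSum {k : ℕ} [NeZero k] (e : ℕ) (f : (Fin n → ZMod p) → ZMod p)
    (V : Fin k → Fin n → ZMod p) : ZMod p :=
  ∑ t : Fin k → ZMod p, t 0 ^ e * f (∑ i, t i • V i)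

theorem testSum_cons {j : ℕ} (e : ℕ) (f : (Fin n → ZMod p) → ZMod p) (v : Fin n → ZMod p)
    (V : Fin j → Fin n → ZMod p) :
    testSum e f (Fin.cons v V : Fin (j + 1) → Fin n → ZMod p) = spanSum (lineSum e v f) V := by
  rw [testSum, spanSum, ← (Fin.consEquiv fun _ => ZMod p).sum_comp, Fintype.sum_prod_type,
    sum_comm]
  refine sum_congr rfl fun t _ => ?_
  rw [lineSum]
  refine sum_congr rfl fun s _ => ?_
  simp [Fin.consEquiv, Fin.sum_univ_succ, add_comm]

theorem spanSum_cons {j : ℕ} (g : (Fin n → ZMod p) → ZMod p) (v : Fin n → ZMod p)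
    (V : Fin j → Fin n → ZMod p) :
    spanSum g (Fin.cons v V : Fin (j + 1) → Fin n → ZMod p) = spanSum (lineSum 0 v g) V := by
  rw [← testSum_cons]
  simp [testSum, spanSum]

/-- If every first entry in `A` leaves at least `a / b` continuations with property `Q`, there are
at least `A.ncard * a / b` tuples with property `Q`. -/
theorem ncard_mul_le_ncard_cons {E : Type*} [Finite E] {j a b : ℕ} (A : Set E)
    (Q : (Fin (j + 1) → E) → Prop)
    (h : ∀ v ∈ A, a ≤ b * {V : Fin j → E | Q (Fin.cons v V)}.ncard) :
    A.ncard * a ≤ b * {V : Fin (j + 1) → E | Q V}.ncard := by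
  classical
  have := Fintype.ofFinite E
  have e : {V : Fin (j + 1) → E | Q V}.ncard =
      ∑ v : E, {V : Fin j → E | Q (Fin.cons v V)}.ncard := by
    simp only [Set.ncard_eq_toFinset_card', Set.toFinset_ofPred, card_filter]
    rw [← (Fin.consEquiv fun _ => E).sum_comp, Fintype.sum_prod_type]
    rfl
  rw [e, Set.ncard_eq_toFinset_card' A, ← smul_eq_mul, mul_sum]
  refine (card_nsmul_le_sum _ _ _ fun v hv => h v (by simpa using hv)).trans ?_
  exact sum_le_sum_of_subset (subset_univ _)

/-- Summing over a random subspace: each step to a smaller degree succeeds with probability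
`j / (j + 12)`, the last one with probability `1 / p`, and `∏ i / (i + 12) ≥ (j + 1) ^ (-12)`. -/
theorem pow_le_ncard_spanSum (j : ℕ) (g : (Fin n → ZMod p) → ZMod p)
    (hg : HasTop g (j * (p - 1))) :
    p ^ (n * j) ≤ p * (j + 1) ^ 12 * {V : Fin j → Fin n → ZMod p | spanSum g V ≠ 0}.ncard := by
  have hp2 := hp.out.two_le
  have base : ∀ g : (Fin n → ZMod p) → ZMod p, HasTop g 0 →
      1 ≤ {V : Fin 0 → Fin n → ZMod p | spanSum g V ≠ 0}.ncard := by
    intro g hg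
    rw [Nat.one_le_iff_ne_zero, Ne, Set.ncard_eq_zero, ← Ne, ← Set.nonempty_iff_ne_empty]
    exact ⟨0, by simpa [spanSum] using hg.apply_zero_ne⟩
  induction j generalizing g with
  | zero =>
    have := base g (by simpa using hg)
    simp only [Nat.mul_zero, pow_zero, Nat.zero_add, one_pow, mul_one]
    nlinarith
  | succ j ih =>
    rcases j with _ | j
    · have h1 := pow_le_mul_good (Nat.zero_add _) (by simpa using hg)
      have h2 := ncard_mul_le_ncard_cons {v | HasTop (lineSum 0 v g) 0}
        (fun V : Fin 1 → Fin n → ZMod p => spanSum g V ≠ 0) (a := 1) (b := 1) fun v hv => by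
          simpa only [spanSum_cons, one_mul] using base _ hv
      rw [mul_one, one_mul] at h2
      calc p ^ (n * (0 + 1)) = p ^ n := by simp
        _ ≤ _ := h1
        _ ≤ p * {V : Fin 1 → Fin n → ZMod p | spanSum g V ≠ 0}.ncard := Nat.mul_le_mul_left _ h2
        _ ≤ p * (0 + 1 + 1) ^ 12 * _ :=
          Nat.mul_le_mul_right _ (Nat.le_mul_of_pos_right _ (by positivity))
    · have h1 := mul_pow_le_good (by omega) hg
      simp only [Nat.add_sub_cancel] at h1
      set A := {v | HasTop (lineSum 0 v g) ((j + 1) * (p - 1))} with hA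
      set G := {V : Fin (j + 1 + 1) → Fin n → ZMod p | spanSum g V ≠ 0}.ncard with hG
      have h2 : A.ncard * p ^ (n * (j + 1)) ≤ p * (j + 1 + 1) ^ 12 * G := by
        refine ncard_mul_le_ncard_cons A
          (fun V : Fin (j + 1 + 1) → Fin n → ZMod p => spanSum g V ≠ 0) fun v hv => ?_
        simpa only [spanSum_cons] using ih _ hv
      have h5 : (j + 2 + 12) * (j + 2) ^ 12 ≤ (j + 2) * (j + 3) ^ 12 := by
        have hb := one_add_mul_le_pow (a := (1 : ℝ) / (j + 2))
          (by have : (0 : ℝ) ≤ 1 / ((j : ℝ) + 2) := by positivity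
              linarith) 12
        have hj : (0 : ℝ) < (j : ℝ) + 2 := by positivity
        have e1 : (1 + (1 : ℝ) / (j + 2)) ^ 12 = (j + 3) ^ 12 / (j + 2) ^ 12 := by
          rw [← div_pow]; congr 1; field_simp; ring
        have e2 : 1 + ((12 : ℕ) : ℝ) * (1 / (j + 2)) = (j + 2 + 12) / (j + 2) := by
          field_simp; push_cast; ring
        rw [e1, e2, div_le_div_iff₀ hj (by positivity)] at hb
        have : ((j : ℝ) + 2 + 12) * (j + 2) ^ 12 ≤ (j + 2) * (j + 3) ^ 12 := by linarith
        exact_mod_cast this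
      have h6 : (j + 2) * p ^ (n * (j + 1 + 1)) ≤ (j + 2) * (p * (j + 1 + 1 + 1) ^ 12 * G) := by
        calc (j + 2) * p ^ (n * (j + 1 + 1)) = (j + 1 + 1) * p ^ n * p ^ (n * (j + 1)) := by
              rw [mul_add n (j + 1) 1, pow_add]; ring
          _ ≤ (j + 1 + 1 + 12) * A.ncard * p ^ (n * (j + 1)) := Nat.mul_le_mul_right _ h1
          _ = (j + 2 + 12) * (A.ncard * p ^ (n * (j + 1))) := by ring
          _ ≤ (j + 2 + 12) * (p * (j + 1 + 1) ^ 12 * G) := Nat.mul_le_mul_left _ h2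
          _ = p * G * ((j + 2 + 12) * (j + 2) ^ 12) := by ring
          _ ≤ p * G * ((j + 2) * (j + 3) ^ 12) := Nat.mul_le_mul_left _ h5
          _ = _ := by ring
      exact Nat.le_of_mul_le_mul_left h6 (by omega)

end LowDegree

/-! ### The test statistic and its repetition -/

namespace LowDegree
open Finset

section
variable {p n : ℕ} [hp : Fact p.Prime]

/-- The test statistic of a function of degree less than `d` vanishes: it is the sum over `F_p^k`
of a polynomial of degree less than `k * (p - 1)`. -/
theorem testSum_eq_zero {k d e : ℕ} [NeZero k] (hed : e + d = k * (p - 1))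
    {f : (Fin n → ZMod p) → ZMod p} (hf : degP f < d) (V : Fin k → Fin n → ZMod p) :
    testSum e f V = 0 := by
  obtain ⟨P, hP, hPd⟩ := degP_attained f
  set L : Fin n → MvPolynomial (Fin k) (ZMod p) :=
    fun b => ∑ i, MvPolynomial.C (V i b) * MvPolynomial.X i with hL
  have hdeg : (MvPolynomial.X 0 ^ e * MvPolynomial.aeval L P).totalDegree < (p - 1) * k := by
    have hLd : ∀ b, (L b).totalDegree ≤ 1 := fun b => by
      refine MvPolynomial.totalDegree_finsetSum_le fun i _ => ?_
      refine (MvPolynomial.totalDegree_mul _ _).trans ?_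
      rw [MvPolynomial.totalDegree_C, MvPolynomial.totalDegree_X]
    have h1 : (MvPolynomial.aeval L P).totalDegree ≤ P.totalDegree := by
      rw [MvPolynomial.aeval_def, MvPolynomial.eval₂_eq']
      refine MvPolynomial.totalDegree_finsetSum_le fun m hm => ?_
      refine (MvPolynomial.totalDegree_mul _ _).trans ?_
      rw [MvPolynomial.algebraMap_eq, MvPolynomial.totalDegree_C, Nat.zero_add]
      refine (MvPolynomial.totalDegree_finsetProd _ _).trans ?_
      have h2 := MvPolynomial.le_totalDegree hm
      rw [Finsupp.sum_fintype _ _ fun _ => rfl] at h2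
      refine le_trans (sum_le_sum fun i _ => ?_) h2
      refine (MvPolynomial.totalDegree_pow _ _).trans ?_
      exact (Nat.mul_le_mul_left _ (hLd i)).trans_eq (mul_one _)
    have h3 := MvPolynomial.totalDegree_mul
      (MvPolynomial.X (0 : Fin k) ^ e) (MvPolynomial.aeval L P)
    rw [MvPolynomial.totalDegree_X_pow] at h3
    rw [mul_comm (p - 1)]
    omega
  have h := MvPolynomial.sum_eval_eq_zero (K := ZMod p) (σ := Fin k) _
    (by rw [ZMod.card, Fintype.card_fin]; exact hdeg)
  rw [← h, testSum]
  refine sum_congr rfl fun t _ => ?_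
  rw [map_mul, map_pow, MvPolynomial.eval_X, ← hP]
  congr 1
  rw [MvPolynomial.aeval_def, MvPolynomial.eval_eq', MvPolynomial.eval₂_eq', map_sum]
  simp [hL, mul_comm]

/-- The test statistic of a function of degree exactly `d` is nonzero with probability at least
`1 / (2 p k ^ 12)`. The weighted direction comes first: it uses only `p - 1 - e` of the degree, so
for `k ≥ 2` it succeeds with probability at least `1 / 2`. -/
theorem pow_le_ncard_testSum {k d e : ℕ} [NeZero k] (hed : e + d = k * (p - 1)) (he : e < p - 1)
    {f : (Fin n → ZMod p) → ZMod p} (hf : degP f = d) (hd : 1 ≤ d) :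
    p ^ (k * n) ≤ 2 * p * k ^ 12 * {V : Fin k → Fin n → ZMod p | testSum e f V ≠ 0}.ncard := by
  have hp2 := hp.out.two_le
  have hft : HasTop f d := hf ▸ hasTop_degP (hf ▸ hd)
  obtain ⟨j, rfl⟩ : ∃ j, k = j + 1 := ⟨k - 1, (Nat.succ_pred (NeZero.ne k)).symm⟩
  obtain ⟨r, hr⟩ : ∃ r, e + r = p - 1 := ⟨p - 1 - e, by omega⟩
  have hdr : d = j * (p - 1) + r := by rw [add_mul, one_mul] at hed; omega
  set A := {v | HasTop (lineSum e v f) (j * (p - 1))} with hA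
  have hAcard : p ^ n ≤ (if j = 0 then p else 2) * A.ncard := by
    split_ifs with hj
    · subst hj
      simp only [zero_mul, Nat.zero_add] at hdr hA
      exact hA ▸ pow_le_mul_good hr (hdr ▸ hft)
    · have h1 : p - 1 ≤ j * (p - 1) := Nat.le_mul_of_pos_left _ (by omega)
      have := pow_le_two_mul_good hr (by omega : 2 * r ≤ d) hft
      rwa [hdr, Nat.add_sub_cancel] at this
  set G := {V : Fin (j + 1) → Fin n → ZMod p | testSum e f V ≠ 0}.ncard with hG
  have hcons : ∀ b a : ℕ, (∀ v ∈ A, a ≤ b *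
      {V : Fin j → Fin n → ZMod p | spanSum (lineSum e v f) V ≠ 0}.ncard) → A.ncard * a ≤ b * G :=
    fun b a h => by
      refine ncard_mul_le_ncard_cons A (fun V => testSum e f V ≠ 0) fun v hv => ?_
      simpa only [testSum_cons] using h v hv
  split_ifs at hAcard with hj
  · subst hj
    have h1 := hcons 1 1 fun v hv => by
      rw [one_mul, Nat.one_le_iff_ne_zero, Ne, Set.ncard_eq_zero, ← Ne,
        ← Set.nonempty_iff_ne_empty]
      refine ⟨0, ?_⟩
      have : HasTop (lineSum e v f) 0 := by simpa [hA] using hv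
      simpa [spanSum] using this.apply_zero_ne
    calc p ^ ((0 + 1) * n) = p ^ n := by simp
      _ ≤ p * A.ncard := hAcard
      _ ≤ p * G := Nat.mul_le_mul_left _ (by omega)
      _ ≤ _ := Nat.mul_le_mul_right _ (by omega)
  · have h1 := hcons _ _ fun v hv => pow_le_ncard_spanSum j _ hv
    calc p ^ ((j + 1) * n) = p ^ n * p ^ (n * j) := by rw [← pow_add]; ring_nf
      _ ≤ 2 * A.ncard * p ^ (n * j) := Nat.mul_le_mul_right _ hAcard
      _ = 2 * (A.ncard * p ^ (n * j)) := by ring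
      _ ≤ 2 * (p * (j + 1) ^ 12 * G) := Nat.mul_le_mul_left _ h1
      _ = _ := by ring

end

/-- Block `i` of length `m` of the random sequence. -/
def block {p : ℕ} (m i : ℕ) (ω : ℕ → ZMod p) (a : Fin m) : ZMod p := ω (i * m + a)

/-- The sequences of length `R * m + u` split into `R` blocks of length `m` and a rest. -/
def splitBlocks (F : Type*) (R m u : ℕ) :
    (Fin (R * m + u) → F) ≃ (Fin R → Fin m → F) × (Fin u → F) :=
  ((Equiv.arrowCongr finSumFinEquiv.symm (Equiv.refl F)).trans
    (Equiv.sumArrowEquivProdArrow _ _ _)).trans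
    (Equiv.prodCongr ((Equiv.arrowCongr finProdFinEquiv.symm (Equiv.refl F)).trans
      (Equiv.curry _ _ _)) (Equiv.refl _))

theorem splitBlocks_fst {p R m u : ℕ} (r : Fin (R * m + u) → ZMod p) (i : Fin R) :
    (splitBlocks (ZMod p) R m u r).1 i = block m i (extend r) := by
  funext a
  have h : (i : ℕ) * m + a < R * m + u := by
    have : ((i : ℕ) + 1) * m ≤ R * m := Nat.mul_le_mul_right _ i.2
    have := a.2
    rw [add_mul] at *
    omega
  simp only [block, extend, h, dite_true]
  simp [splitBlocks, Equiv.sumArrowEquivProdArrow, Function.curry, Equiv.arrowCongr]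
  congr 1
  ext
  simp
  ring

theorem card_all_blocks {p : ℕ} [NeZero p] (R m u : ℕ) (S : Set (Fin m → ZMod p)) :
    {r : Fin (R * m + u) → ZMod p | ∀ i < R, block m i (extend r) ∈ S}.ncard =
      S.ncard ^ R * p ^ u := by
  classical
  have h : {r : Fin (R * m + u) → ZMod p | ∀ i < R, block m i (extend r) ∈ S} =
      splitBlocks (ZMod p) R m u ⁻¹' (Set.pi Set.univ (fun _ => S) ×ˢ Set.univ) := by
    ext r
    simp only [Set.mem_ofPred_eq, Set.mem_preimage, Set.mem_prod, Set.mem_pi, Set.mem_univ,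
      and_true, forall_true_left, splitBlocks_fst]
    exact ⟨fun h i => h i i.2, fun h i hi => h ⟨i, hi⟩⟩
  rw [h, ← Set.ncard_image_of_injective _ (splitBlocks (ZMod p) R m u).injective,
    Set.image_preimage_eq _ (splitBlocks (ZMod p) R m u).surjective, Set.ncard_prod]
  congr 1
  · rw [Set.ncard_eq_toFinset_card', Set.ncard_eq_toFinset_card',
      show (Set.pi Set.univ fun _ : Fin R => S).toFinset = Fintype.piFinset fun _ => S.toFinset by
        ext; simp]
    simp
  · simp [Set.ncard_univ]

theorem one_sub_inv_pow_le {M : ℕ} (hM : 0 < M) : (1 - 1 / (M : ℝ)) ^ (5 * M) ≤ 1 / 100 := by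
  have hM' : (1 : ℝ) ≤ M := by exact_mod_cast hM
  have h0 : 0 ≤ 1 - 1 / (M : ℝ) := by
    rw [sub_nonneg, div_le_one (by linarith)]; exact hM'
  have h1 : 1 - 1 / (M : ℝ) ≤ Real.exp (-(1 / (M : ℝ))) := by
    have := Real.add_one_le_exp (-(1 / (M : ℝ))); linarith
  calc (1 - 1 / (M : ℝ)) ^ (5 * M) ≤ Real.exp (-(1 / (M : ℝ))) ^ (5 * M) :=
        pow_le_pow_left₀ h0 h1 _
    _ = (Real.exp 1 ^ 5)⁻¹ := by
        rw [← Real.exp_nat_mul, ← Real.exp_nat_mul, ← Real.exp_neg]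
        congr 1
        push_cast
        field_simp
    _ ≤ 1 / 100 := by
        rw [one_div]
        refine inv_anti₀ (by norm_num) ?_
        calc (100 : ℝ) ≤ 2.7 ^ 5 := by norm_num
          _ ≤ Real.exp 1 ^ 5 := pow_le_pow_left₀ (by norm_num)
            (by have := Real.exp_one_gt_d9; linarith) _

/-- If an event on `m` random elements has probability at least `1 / M`, it happens in one of
`5 * M` disjoint blocks with probability at least `99 / 100`. -/
theorem prob_exists_block_ge {p m M T : ℕ} [NeZero p] (S : Set (Fin m → ZMod p))
    (hS : p ^ m ≤ M * S.ncard) (hT : 5 * M * m ≤ T) :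
    99 / 100 ≤ prob p T fun ω => ∃ i < 5 * M, block m i ω ∈ S := by
  classical
  have hp0 : 0 < p := Nat.pos_of_ne_zero (NeZero.ne p)
  have hM : 0 < M := by
    rcases Nat.eq_zero_or_pos M with rfl | h
    · have : 0 < p ^ m := by positivity
      omega
    · exact h
  obtain ⟨u, rfl⟩ := Nat.exists_eq_add_of_le hT
  have hc := card_all_blocks (5 * M) m u Sᶜ
  set bad := {r : Fin (5 * M * m + u) → ZMod p | ∀ i < 5 * M, block m i (extend r) ∈ Sᶜ} with hbad
  have hsum := Set.ncard_add_ncard_compl bad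
  have hSc := Set.ncard_add_ncard_compl S
  rw [Nat.card_eq_fintype_card, Fintype.card_fun, Fintype.card_fin, ZMod.card] at hsum hSc
  have hgood : (univ.filter fun r : Fin (5 * M * m + u) → ZMod p =>
      ∃ i < 5 * M, block m i (extend r) ∈ S).card = badᶜ.ncard := by
    rw [Set.ncard_eq_toFinset_card']
    congr 1
    ext r
    simp [hbad]
  have hM' : (0 : ℝ) < M := by exact_mod_cast hM
  have hp' : (0 : ℝ) < p := by exact_mod_cast hp0
  have h1 : (Sᶜ.ncard : ℝ) ≤ p ^ m * (1 - 1 / M) := by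
    have e1 : (S.ncard : ℝ) + Sᶜ.ncard = p ^ m := by exact_mod_cast hSc
    have e2 : (p : ℝ) ^ m ≤ M * S.ncard := by exact_mod_cast hS
    have e3 : (p : ℝ) ^ m / M ≤ S.ncard := by rw [div_le_iff₀ hM']; linarith
    rw [mul_sub, mul_one_div]
    linarith
  have h2 : (bad.ncard : ℝ) ≤ p ^ (5 * M * m + u) * (1 / 100) := by
    calc (bad.ncard : ℝ) = (Sᶜ.ncard : ℝ) ^ (5 * M) * p ^ u := by exact_mod_cast hc
      _ ≤ (p ^ m * (1 - 1 / M)) ^ (5 * M) * p ^ u :=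
        mul_le_mul_of_nonneg_right (pow_le_pow_left₀ (by positivity) h1 _) (by positivity)
      _ = p ^ (5 * M * m + u) * (1 - 1 / (M : ℝ)) ^ (5 * M) := by
        rw [mul_pow, ← pow_mul, pow_add, mul_comm m]; ring
      _ ≤ _ := mul_le_mul_of_nonneg_left (one_sub_inv_pow_le hM) (by positivity)
  have h3 : (bad.ncard : ℝ) + badᶜ.ncard = p ^ (5 * M * m + u) := by exact_mod_cast hsum
  rw [prob, le_div_iff₀ (by positivity)]
  have e4 : ((Fintype.card (Fin (5 * M * m + u) → ZMod p) : ℕ) : ℝ) = p ^ (5 * M * m + u) := by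
    rw [Fintype.card_fun, Fintype.card_fin, ZMod.card]; push_cast; rfl
  rw [e4]
  have e5 : ((univ.filter fun r : Fin (5 * M * m + u) → ZMod p =>
      ∃ i < 5 * M, block m i (extend r) ∈ S).card : ℝ) = badᶜ.ncard := by exact_mod_cast hgood
  calc _ ≤ (badᶜ.ncard : ℝ) := by linarith
    _ = _ := by rw [← e5]; congr

end LowDegree

/-! ### Programs with time bounds -/

namespace LowDegree
open Finset

@[simp] theorem State.reg_setReg (s : State) (x v y : ℕ) :
    (s.setReg x v).reg y = if y = x then v else s.reg y := by
  simp [State.setReg, Function.update_apply]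

@[simp] theorem State.mem_setReg (s : State) (x v : ℕ) : (s.setReg x v).mem = s.mem := rfl

@[simp] theorem State.pos_setReg (s : State) (x v : ℕ) : (s.setReg x v).pos = s.pos := rfl

@[simp] theorem State.reg_setMem (s : State) (a v : ℕ) : (s.setMem a v).reg = s.reg := rfl

@[simp] theorem State.mem_setMem (s : State) (a v b : ℕ) :
    (s.setMem a v).mem b = if b = a then v else s.mem b := by
  simp [State.setMem, Function.update_apply]

@[simp] theorem State.pos_setMem (s : State) (a v : ℕ) : (s.setMem a v).pos = s.pos := rfl

/-- A list of programs, one after the other. -/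
def seqs : List Prog → Prog
  | [] => Prog.skip
  | A :: l => Prog.seq A (seqs l)

/-- Total correctness with a time bound: started in `s`, the program `A` halts within `B` steps in
a state that satisfies `Q`. -/
def Run {p n : ℕ} (f : (Fin n → ZMod p) → ZMod p) (ω : ℕ → ZMod p) (A : Prog) (s : State)
    (B : ℕ) (Q : State → Prop) : Prop :=
  ∃ t ≤ B, ∃ s', Exec f ω A s t s' ∧ Q s'

/-- The two states have the same registers below `L`. Subprograms are organized so that each
changes only registers from some number on. -/
def Agree (L : ℕ) (s s' : State) : Prop := ∀ y < L, s'.reg y = s.reg y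

namespace Run

variable {p n : ℕ} {f : (Fin n → ZMod p) → ZMod p} {ω : ℕ → ZMod p} {A : Prog} {s : State}
  {B B' : ℕ} {Q Q' : State → Prop} {l : List Prog} {x y z c : ℕ}

theorem mono (h : Run f ω A s B Q) (hB : B ≤ B') (hQ : ∀ s', Q s' → Q' s') :
    Run f ω A s B' Q' := by
  obtain ⟨t, ht, s', he, hq⟩ := h
  exact ⟨t, ht.trans hB, s', he, hQ s' hq⟩

theorem seqs_nil (h : Q s) : Run f ω (seqs []) s 1 Q := ⟨1, le_rfl, s, .skip s, h⟩

theorem seqs_cons (h : Run f ω A s B' fun s₁ => Run f ω (seqs l) s₁ B Q) :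
    Run f ω (seqs (A :: l)) s (B + B') Q := by
  obtain ⟨t, ht, s', he, t', ht', s'', he', hq⟩ := h
  exact ⟨t + t', by omega, s'', .seq he he', hq⟩

theorem skip (h : Q s) : Run f ω .skip s 1 Q := ⟨1, le_rfl, s, .skip s, h⟩

theorem const (h : Q (s.setReg x c)) : Run f ω (.const x c) s 1 Q := ⟨1, le_rfl, _, .const .., h⟩

theorem copy (h : Q (s.setReg x (s.reg y))) : Run f ω (.copy x y) s 1 Q :=
  ⟨1, le_rfl, _, .copy .., h⟩

theorem add (h : Q (s.setReg x (s.reg y + s.reg z))) : Run f ω (.add x y z) s 1 Q :=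
  ⟨1, le_rfl, _, .add .., h⟩

theorem sub (h : Q (s.setReg x (s.reg y - s.reg z))) : Run f ω (.sub x y z) s 1 Q :=
  ⟨1, le_rfl, _, .sub .., h⟩

theorem fadd (h : Q (s.setReg x ((s.reg y + s.reg z) % p))) : Run f ω (.fadd x y z) s 1 Q :=
  ⟨1, le_rfl, _, .fadd .., h⟩

theorem fmul (h : Q (s.setReg x ((s.reg y * s.reg z) % p))) : Run f ω (.fmul x y z) s 1 Q :=
  ⟨1, le_rfl, _, .fmul .., h⟩

theorem load (h : Q (s.setReg x (s.mem (s.reg y)))) : Run f ω (.load x y) s 1 Q :=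
  ⟨1, le_rfl, _, .load .., h⟩

theorem store (h : Q (s.setMem (s.reg x) (s.reg y))) : Run f ω (.store x y) s 1 Q :=
  ⟨1, le_rfl, _, .store .., h⟩

theorem rand (h : Q { s.setReg x (ω s.pos).val with pos := s.pos + 1 }) :
    Run f ω (.rand x) s 1 Q :=
  ⟨1, le_rfl, _, .rand .., h⟩

theorem query (h : Q (s.setReg x (f fun i : Fin n => (s.mem (s.reg y + i) : ZMod p)).val)) :
    Run f ω (.query x y) s 1 Q :=
  ⟨1, le_rfl, _, .query .., h⟩

theorem cond {A' : Prog} (h : s.reg x ≠ 0 → Run f ω A s B Q)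
    (h' : s.reg x = 0 → Run f ω A' s B Q) : Run f ω (.cond x A A') s (B + 1) Q := by
  by_cases hx : s.reg x = 0
  · obtain ⟨t, ht, s', he, hq⟩ := h' hx
    exact ⟨t + 1, by omega, s', .condFalse hx he, hq⟩
  · obtain ⟨t, ht, s', he, hq⟩ := h hx
    exact ⟨t + 1, by omega, s', .condTrue hx he, hq⟩

/-- The loop rule, for a loop that is known to run exactly `N` times; `I i` is the invariant after
`i` rounds. -/
theorem loop (I : ℕ → State → Prop) (N : ℕ) (h0 : I 0 s)
    (hstep : ∀ i < N, ∀ s, I i s → s.reg x ≠ 0 ∧ Run f ω A s B (I (i + 1)))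
    (hend : ∀ s, I N s → s.reg x = 0 ∧ Q s) :
    Run f ω (.loop x A) s (N * (B + 1) + 1) Q := by
  have key : ∀ m ≤ N, ∀ s, I (N - m) s → Run f ω (.loop x A) s (m * (B + 1) + 1) Q := by
    intro m
    induction m with
    | zero =>
      intro _ s hs
      obtain ⟨hx, hq⟩ := hend s hs
      exact ⟨1, by omega, s, .loopExit hx, hq⟩
    | succ m ih =>
      intro hm s hs
      obtain ⟨hx, t, ht, s₁, he, h₁⟩ := hstep _ (by omega) s hs
      rw [show N - (m + 1) + 1 = N - m by omega] at h₁
      obtain ⟨t', ht', s', he', hq⟩ := ih (by omega) s₁ h₁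
      exact ⟨t + t' + 1, by rw [add_mul]; omega, s', .loopStep hx he he', hq⟩
  exact key N le_rfl s (by rwa [Nat.sub_self])

end Run

/-- `x := y * z`, with counter `c`. Register `3` always holds `1`. -/
def mulTo (x y z c : ℕ) : Prog :=
  seqs [.const x 0, .copy c z, .loop c (seqs [.add x x y, .sub c c 3])]

/-- `x := x * b ^ c`, destroying `c`, with auxiliary registers `t` and `u`. -/
def powTo (x b c t u : ℕ) : Prog :=
  .loop c (seqs [mulTo t x b u, .copy x t, .sub c c 3])

section
variable {p n : ℕ} {f : (Fin n → ZMod p) → ZMod p} {ω : ℕ → ZMod p}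

theorem run_mulTo {x y z c : ℕ} {s : State} (h3 : s.reg 3 = 1) (hx3 : x ≠ 3) (hc3 : c ≠ 3)
    (hxy : x ≠ y) (hxz : x ≠ z) (hxc : x ≠ c) (hcy : c ≠ y) :
    Run f ω (mulTo x y z c) s (4 * s.reg z + 4) fun s' =>
      (∀ r, r ≠ x → r ≠ c → s'.reg r = s.reg r) ∧ s'.reg x = s.reg y * s.reg z ∧
        s'.mem = s.mem ∧ s'.pos = s.pos := by
  refine Run.mono (B := 1 + (s.reg z * (3 + 1) + 1) + 1 + 1) (.seqs_cons <| .const <| .seqs_cons <|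
    .copy <| .seqs_cons <| .loop (fun i s' => (∀ r, r ≠ x → r ≠ c → s'.reg r = s.reg r) ∧
      s'.reg x = s.reg y * i ∧ s'.reg c = s.reg z - i ∧ s'.mem = s.mem ∧ s'.pos = s.pos) (s.reg z)
      ?_ ?_ ?_) (by omega) fun _ h => h
  · refine ⟨fun r h1 h2 => by simp [h1, h2], ?_, ?_, rfl, rfl⟩ <;> simp [hxc, hxz.symm]
  · rintro i hi s' ⟨hr, hx, hc, hm, hp⟩
    refine ⟨by omega, .seqs_cons <| .add <| .seqs_cons <| .sub <| .seqs_nil ?_⟩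
    have h3' := hr 3 hx3.symm hc3.symm
    have hy := hr y hxy.symm hcy.symm
    refine ⟨fun r h1 h2 => by simp [h1, h2, hr], ?_, ?_, hm, hp⟩
    · simp [hxc, hx, hy]; ring
    · simp [hxc.symm, hx3.symm, hc, h3', h3]; omega
  · rintro s' ⟨hr, hx, hc, hm, hp⟩
    exact ⟨by omega, .seqs_nil ⟨hr, hx, hm, hp⟩⟩

theorem run_powTo {x b c t u : ℕ} {s : State} (h3 : s.reg 3 = 1) (hx3 : x ≠ 3) (hc3 : c ≠ 3)
    (ht3 : t ≠ 3) (hu3 : u ≠ 3) (hxb : x ≠ b) (hxc : x ≠ c) (hcb : c ≠ b) (htx : t ≠ x)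
    (htb : t ≠ b) (htc : t ≠ c) (htu : t ≠ u) (hux : u ≠ x) (huc : u ≠ c) (hub : u ≠ b) :
    Run f ω (powTo x b c t u) s (s.reg c * (4 * s.reg b + 8) + 1) fun s' =>
      (∀ r, r ≠ x → r ≠ c → r ≠ t → r ≠ u → s'.reg r = s.reg r) ∧
        s'.reg x = s.reg x * s.reg b ^ s.reg c ∧ s'.mem = s.mem ∧ s'.pos = s.pos := by
  refine Run.mono (B := s.reg c * ((1 + 1 + 1 + (4 * s.reg b + 4)) + 1) + 1)
    (.loop (fun i s' => (∀ r, r ≠ x → r ≠ c → r ≠ t → r ≠ u → s'.reg r = s.reg r) ∧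
      s'.reg x = s.reg x * s.reg b ^ i ∧ s'.reg c = s.reg c - i ∧ s'.mem = s.mem ∧
        s'.pos = s.pos) (s.reg c) ?_ ?_ ?_) (by ring_nf; omega) fun _ h => h
  · exact ⟨fun _ _ _ _ _ => rfl, by simp, by simp, rfl, rfl⟩
  · rintro i hi s' ⟨hr, hx, hc, hm, hp⟩
    have h3' := hr 3 hx3.symm hc3.symm ht3.symm hu3.symm
    have hb := hr b hxb.symm hcb.symm htb.symm hub.symm
    refine ⟨by omega, .seqs_cons ((run_mulTo (h3'.trans h3) ht3 hu3 htx htb htu hux).mono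
      (by rw [hb]) ?_)⟩
    rintro s₁ ⟨hr₁, hx₁, hm₁, hp₁⟩
    refine .seqs_cons <| .copy <| .seqs_cons <| .sub <| .seqs_nil ?_
    have h3₁ := hr₁ 3 ht3.symm hu3.symm
    have hc₁ := hr₁ c htc.symm huc.symm
    refine ⟨fun r h1 h2 h4 h5 => by simp [h1, h2, hr₁ r h4 h5, hr r h1 h2 h4 h5], ?_, ?_,
      hm₁.trans hm, hp₁.trans hp⟩
    · simp [hxc, hx₁, hx, hb, pow_succ, mul_assoc]
    · simp [hxc.symm, hx3.symm, hc₁, hc, h3₁, h3', h3]; omega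
  · rintro s' ⟨hr, hx, hc, hm, hp⟩
    exact ⟨by omega, hr, hx, hm, hp⟩

/-- Add the vector at address `reg 22`, times the carry in register `20`, to the point at address
`p`. -/
def addRow : Prog :=
  seqs [.copy 24 0, .copy 25 2, .copy 26 22,
    .loop 24 (seqs [.load 27 25, .load 28 26, .fmul 28 28 20, .fadd 27 27 28, .store 25 27,
      .add 25 25 3, .add 26 26 3, .sub 24 24 3])]

theorem run_addRow {s : State} (h0 : s.reg 0 = n) (h2 : s.reg 2 = p) (h3 : s.reg 3 = 1)
    (hv : p + n ≤ s.reg 22) :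
    Run f ω addRow s (10 * n + 5) fun s' => Agree 24 s s' ∧ s'.pos = s.pos ∧
      (∀ a, a < p ∨ p + n ≤ a → s'.mem a = s.mem a) ∧
      ∀ j < n, (s'.mem (p + j) : ZMod p) = s.mem (p + j) + s.mem (s.reg 22 + j) * s.reg 20 := by
  refine Run.mono (B := 1 + (n * (9 + 1) + 1) + 1 + 1 + 1) (.seqs_cons <| .copy <| .seqs_cons <|
    .copy <| .seqs_cons <| .copy <| .seqs_cons <| .loop (fun i s' => Agree 24 s s' ∧
      s'.pos = s.pos ∧ s'.reg 24 = n - i ∧ s'.reg 25 = p + i ∧ s'.reg 26 = s.reg 22 + i ∧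
      (∀ a, a < p ∨ p + n ≤ a → s'.mem a = s.mem a) ∧
      ∀ j < n, (s'.mem (p + j) : ZMod p) = s.mem (p + j) + if j < i then
        (s.mem (s.reg 22 + j) * s.reg 20 : ZMod p) else 0) n
      ?_ ?_ ?_) (by omega) fun _ h => h
  · refine ⟨fun y hy => ?_, rfl, by simp [h0], by simp [h2], by simp, fun _ _ => rfl, by simp⟩
    have h1 : y ≠ 24 := by omega
    have h2 : y ≠ 25 := by omega
    have h3 : y ≠ 26 := by omega
    simp [h1, h2, h3]
  · rintro i hi s' ⟨hA, hp, h24, h25, h26, hm, hx⟩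
    refine ⟨by omega, .seqs_cons <| .load <| .seqs_cons <| .load <| .seqs_cons <| .fmul <|
      .seqs_cons <| .fadd <| .seqs_cons <| .store <| .seqs_cons <| .add <| .seqs_cons <| .add <|
      .seqs_cons <| .sub <| .seqs_nil ?_⟩
    have h3' := hA 3 (by omega)
    have h20 := hA 20 (by omega)
    refine ⟨fun y hy => ?_, by simpa using hp, ?_, ?_, ?_, fun a ha => ?_, fun j hj => ?_⟩
    · have h1 : y ≠ 24 := by omega
      have h2 : y ≠ 25 := by omega
      have h3 : y ≠ 26 := by omega
      have h4 : y ≠ 27 := by omega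
      have h5 : y ≠ 28 := by omega
      simp [h1, h2, h3, h4, h5, hA y hy]
    · simp [h24, h3', h3]; omega
    · simp [h25, h3', h3]; omega
    · simp [h26, h3', h3]; omega
    · have : a ≠ p + i := by omega
      simp [h25, this, hm a ha]
    · by_cases hji : j = i
      · subst hji
        have h1 := hx j hj
        have h2 := hm (s.reg 22 + j) (by omega)
        simp only [lt_irrefl, if_false, add_zero] at h1
        simp [h25, h26, h1, h2, h20]
      · have h1 : (j < i + 1) = (j < i) := by simp; omega
        simp [h25, hji, hx j hj, h1]
  · rintro s' ⟨hA, hp, h24, h25, h26, hm, hx⟩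
    refine ⟨by omega, .seqs_nil ⟨hA, hp, hm, fun j hj => ?_⟩⟩
    rw [hx j hj, if_pos hj]

end

end LowDegree

/-! ### Enumerating `F_p^k` -/

namespace LowDegree
open Finset

/-- The contents of the registers that stay fixed during the trials. The memory cells below `p`
hold the table of weights, the next `n` the point, the next `k` the digits, and the next `k * n` the
vectors, so that registers `2`, `6` and `7` hold the first addresses of point, digits and vectors.
Register `3` holds the constant `1`. -/
structure Consts (p n k : ℕ) (s : State) : Prop where
  r0 : s.reg 0 = n
  r2 : s.reg 2 = p
  r3 : s.reg 3 = 1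
  r4 : s.reg 4 = k
  r6 : s.reg 6 = p + n
  r7 : s.reg 7 = p + n + k
  r8 : s.reg 8 = n + k
  r9 : s.reg 9 = k * n
  r10 : s.reg 10 = p ^ k

theorem Consts.of_agree {p n k L : ℕ} {s s' : State} (h : Consts p n k s) (hA : Agree L s s')
    (hL : 11 ≤ L) : Consts p n k s' :=
  ⟨(hA 0 (by omega)).trans h.r0, (hA 2 (by omega)).trans h.r2, (hA 3 (by omega)).trans h.r3,
    (hA 4 (by omega)).trans h.r4, (hA 6 (by omega)).trans h.r6, (hA 7 (by omega)).trans h.r7,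
    (hA 8 (by omega)).trans h.r8, (hA 9 (by omega)).trans h.r9, (hA 10 (by omega)).trans h.r10⟩

theorem Agree.refl (L : ℕ) (s : State) : Agree L s s := fun _ _ => rfl

theorem Agree.trans {L L' : ℕ} {s s' s'' : State} (h : Agree L s s') (h' : Agree L' s' s'')
    (hL : L ≤ L') : Agree L s s'' :=
  fun y hy => (h' y (hy.trans_le hL)).trans (h y hy)

theorem Agree.setReg {L : ℕ} {s s' : State} (h : Agree L s s') {x : ℕ} (hx : L ≤ x) (v : ℕ) :
    Agree L s (s'.setReg x v) := fun y hy => by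
  have : y ≠ x := by omega
  simp [this, h y hy]

theorem Agree.setMem {L : ℕ} {s s' : State} (h : Agree L s s') (a v : ℕ) :
    Agree L s (s'.setMem a v) := h

/-- The table of the weights `a ^ e` occupies the memory cells below `p`. -/
def Table (p e : ℕ) (mem : ℕ → ℕ) : Prop := ∀ a < p, (mem a : ZMod p) = (a : ZMod p) ^ e

/-- The memory during the enumeration of `F_p^k`: the weights, the point, the digits `t`, and the
vectors `V`. Digit `i` is that of the counter `μ i`; the counters differ only while a carry runs
through the digits. The point is `∑ t i • V i`, where `μ i / p ^ i` has residue `t i`. -/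
structure Config {p n k : ℕ} (V : Fin k → Fin n → ZMod p) (e : ℕ) (μ : ℕ → ℕ) (mem : ℕ → ℕ) :
    Prop where
  table : Table p e mem
  point : ∀ b : Fin n, (mem (p + b) : ZMod p) = 
    ∑ a : Fin k, ((μ a / p ^ (a : ℕ) : ℕ) : ZMod p) * V a b
  digit : ∀ i < k, mem (p + n + i) = μ i / p ^ i % p
  vec : ∀ (a : Fin k) (b : Fin n), (mem (p + n + k + a * n + b) : ZMod p) = V a b

theorem Config.congr {p n k e : ℕ} {V : Fin k → Fin n → ZMod p} {μ ν mem : ℕ → ℕ}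
    (h : Config V e μ mem) (hμ : ∀ i < k, μ i = ν i) : Config V e ν mem where
  table := h.table
  point b := by
    rw [h.point]
    exact sum_congr rfl fun a _ => by rw [hμ a a.2]
  digit i hi := by rw [h.digit i hi, hμ i hi]
  vec := h.vec

/-- Processing digit `i` during an increment of the counter from `m` to `m + 1`: the carry is `1`
exactly if `p ^ i` divides `m + 1`. -/
theorem Config.step {p n k e m i : ℕ} [Fact p.Prime] {V : Fin k → Fin n → ZMod p}
    {mem mem' : ℕ → ℕ} (hi : i < k)
    (h : Config V e (fun a => if a < i then m + 1 else m) mem)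
    (hm : ∀ a, a < p ∨ p + n ≤ a → mem' a = mem a)
    (hx : ∀ j < n, (mem' (p + j) : ZMod p) = mem (p + j) + mem (p + n + k + i * n + j) *
      ((if p ^ i ∣ m + 1 then 1 else 0 : ℕ) : ZMod p)) :
    Config V e (fun a => if a < i + 1 then m + 1 else m)
      (Function.update mem' (p + n + i)
        ((mem' (p + n + i) + if p ^ i ∣ m + 1 then 1 else 0) % p)) where
  table a ha := by
    have : a ≠ p + n + i := by omega
    rw [Function.update_of_ne this, hm a (by omega)]
    exact h.table a ha
  point b := by
    have hb := b.2
    rw [Function.update_of_ne (by omega), hx b hb, h.point,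
      ← add_sum_erase univ _ (mem_univ (⟨i, hi⟩ : Fin k)),
      ← add_sum_erase univ _ (mem_univ (⟨i, hi⟩ : Fin k)),
      show (mem (p + n + k + i * n + b) : ZMod p) = V ⟨i, hi⟩ b from h.vec ⟨i, hi⟩ b]
    have he : ∀ a ∈ univ.erase (⟨i, hi⟩ : Fin k), 
        (if (a : ℕ) < i + 1 then m + 1 else m) = if (a : ℕ) < i then m + 1 else m := by
      intro a ha
      have : (a : ℕ) ≠ i := fun h => (mem_erase.1 ha).1 (Fin.ext h)
      split_ifs <;> omega
    rw [sum_congr rfl fun a ha => by rw [← he a ha]]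
    simp only [lt_irrefl, if_false, Nat.lt_succ_self, if_true, Nat.succ_div]
    push_cast
    ring
  digit j hj := by
    by_cases hji : j = i
    · subst hji
      rw [Function.update_self, hm _ (by omega), h.digit j hj]
      simp only [lt_irrefl, if_false, Nat.lt_succ_self, if_true, Nat.succ_div, Nat.mod_add_mod]
    · have : (j < i + 1) = (j < i) := by simp; omega
      rw [Function.update_of_ne (by omega), hm _ (by omega), h.digit j hj]
      simp only [this]
  vec a b := by
    rw [Function.update_of_ne (by omega), hm _ (by omega), h.vec]

/-- The carry survives digit `i` exactly if the incremented digit is zero. -/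
theorem carry_step {p m i : ℕ} :
    (if ((m + 1) / p ^ i % p) ≠ 0 then 0 else if p ^ i ∣ m + 1 then 1 else 0) =
      if p ^ (i + 1) ∣ m + 1 then 1 else 0 := by
  by_cases h : p ^ i ∣ m + 1
  · have : p ^ (i + 1) ∣ m + 1 ↔ (m + 1) / p ^ i % p = 0 := by
      rw [← Nat.dvd_iff_mod_eq_zero, pow_succ, Nat.dvd_div_iff_mul_dvd h]
    simp only [h, this, if_true]
    split_ifs <;> first | rfl | omega
  · have : ¬ p ^ (i + 1) ∣ m + 1 := fun h' => h ((pow_dvd_pow p (Nat.le_succ i)).trans h')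
    simp [h, this]

/-- Increment the digits `t` and update the point. Register `20` holds the carry, `21` counts the
remaining digits, `22` and `23` point to the current vector and digit. -/
def incr : Prog :=
  seqs [.const 20 1, .copy 21 4, .copy 22 7, .copy 23 6,
    .loop 21 (seqs [addRow, .load 24 23, .fadd 24 24 20, .store 23 24,
      .cond 24 (.const 20 0) .skip, .add 22 22 0, .add 23 23 3, .sub 21 21 3])]

variable {p n : ℕ} [hp : Fact p.Prime] {f : (Fin n → ZMod p) → ZMod p} {ω : ℕ → ZMod p}

theorem run_incr {k e m : ℕ} {V : Fin k → Fin n → ZMod p} {s : State} (hs : Consts p n k s)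
    (hm : Config V e (fun _ => m) s.mem) :
    Run f ω incr s (k * (10 * n + 15) + 6) fun s' => Agree 20 s s' ∧ s'.pos = s.pos ∧
      Config V e (fun _ => m + 1) s'.mem := by
  refine Run.mono (B := 1 + (k * ((9 + (10 * n + 5)) + 1) + 1) + 1 + 1 + 1 + 1) (.seqs_cons <|
    .const <| .seqs_cons <| .copy <| .seqs_cons <| .copy <| .seqs_cons <| .copy <| .seqs_cons <|
    .loop (fun i s' => Agree 20 s s' ∧ s'.pos = s.pos ∧
      s'.reg 20 = (if p ^ i ∣ m + 1 then 1 else 0) ∧ s'.reg 21 = k - i ∧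
      s'.reg 22 = p + n + k + i * n ∧ s'.reg 23 = p + n + i ∧
      Config V e (fun a => if a < i then m + 1 else m) s'.mem) k
      ?_ ?_ ?_) (by ring_nf; omega) fun _ h => h
  · refine ⟨.setReg (.setReg (.setReg (.setReg (.refl _ _) (by omega) _) (by omega) _) (by omega) _)
      (by omega) _, rfl, by simp, by simp [hs.r4], by simp [hs.r7], by simp [hs.r6], ?_⟩
    simpa using hm
  · rintro i hi s' ⟨hA, hpos, h20, h21, h22, h23, hC⟩
    have hs' := hs.of_agree hA (by omega)
    refine ⟨by omega, .seqs_cons ((run_addRow hs'.r0 hs'.r2 hs'.r3 (by omega)).mono le_rfl ?_)⟩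
    rintro s₁ ⟨hA₁, hpos₁, hm₁, hx₁⟩
    have hs₁ := hs'.of_agree hA₁ (by omega)
    rw [h20, h22] at hx₁
    have hC₁ := hC.step hi hm₁ hx₁
    have hd := hC₁.digit i hi
    rw [Function.update_self] at hd
    simp only [Nat.lt_succ_self, if_true] at hd
    have g20 := hA₁ 20 (by omega)
    have g21 := hA₁ 21 (by omega)
    have g22 := hA₁ 22 (by omega)
    have g23 := hA₁ 23 (by omega)
    refine .seqs_cons <| .load <| .seqs_cons <| .fadd <| .seqs_cons <| .store ?_
    set st := ((s₁.setReg 24 (s₁.mem (s₁.reg 23))).setReg 24 _).setMem _ _ with hst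
    have hst_mem : st.mem = Function.update s₁.mem (p + n + i)
        ((s₁.mem (p + n + i) + if p ^ i ∣ m + 1 then 1 else 0) % p) := by
      funext b
      simp [hst, g20, g23, h20, h23, Function.update_apply]
    have hst_24 : st.reg 24 = (m + 1) / p ^ i % p := by
      rw [← hd]
      simp [hst, g20, g23, h20, h23]
    have hst_A : Agree 24 s₁ st := by
      rw [hst]
      exact ((Agree.refl _ _).setReg (by omega) _).setReg (by omega) _
    -- the carry is cleared unless the new digit is zero
    refine .seqs_cons (B' := 1 + 1) (Run.mono (Q := fun s₂ => (∀ y, y ≠ 20 → s₂.reg y = st.reg y) ∧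
      s₂.mem = st.mem ∧ s₂.pos = st.pos ∧ s₂.reg 20 = if p ^ (i + 1) ∣ m + 1 then 1 else 0)
      (.cond (fun h => .const ?_) (fun h => .skip ?_)) le_rfl ?_)
    · refine ⟨fun y hy => by simp [hy], rfl, rfl, ?_⟩
      rw [hst_24] at h
      rw [← carry_step, if_pos h]
      simp
    · refine ⟨fun y hy => rfl, rfl, rfl, ?_⟩
      rw [hst_24] at h
      rw [← carry_step, if_neg (not_not.2 h), hst_A 20 (by omega), g20, h20]
    · rintro s₂ ⟨hr₂, hm₂, hp₂, h20₂⟩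
      have hr : ∀ y < 24, y ≠ 20 → s₂.reg y = s'.reg y := fun y hy h =>
        (hr₂ y h).trans ((hst_A y hy).trans (hA₁ y hy))
      refine .seqs_cons <| .add <| .seqs_cons <| .add <| .seqs_cons <| .sub <| .seqs_nil
        ⟨fun y hy => ?_, ?_, ?_, ?_, ?_, ?_, ?_⟩
      · have h1 : y ≠ 21 := by omega
        have h2 : y ≠ 22 := by omega
        have h3 : y ≠ 23 := by omega
        simp only [State.reg_setReg, h1, h2, h3, if_false]
        exact (hr y (by omega) (by omega)).trans (hA y hy)
      · exact hp₂.trans (hpos₁.trans hpos)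
      · simpa using h20₂
      · simp [hr, h21, hs'.r3]; omega
      · simp [hr, h22, hs'.r0]; ring
      · simp [hr, h23, hs'.r3]; omega
      · simp only [State.mem_setReg, hm₂, hst_mem]
        exact hC₁
  · rintro s' ⟨hA, hpos, h20, h21, h22, h23, hC⟩
    exact ⟨by omega, .seqs_nil ⟨hA, hpos, hC.congr fun i hi => by simp [hi]⟩⟩

end LowDegree

/-! ### One trial -/

namespace LowDegree
open Finset

section
variable {p n : ℕ} {f : (Fin n → ZMod p) → ZMod p} {ω : ℕ → ZMod p}

/-- Store fresh random elements in the memory of the vectors. -/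
def fill : Prog :=
  seqs [.copy 18 9, .copy 19 7,
    .loop 18 (seqs [.rand 20, .store 19 20, .add 19 19 3, .sub 18 18 3])]

/-- Set the point and the digits to zero. -/
def clear : Prog :=
  seqs [.copy 18 8, .copy 19 2, .const 20 0,
    .loop 18 (seqs [.store 19 20, .add 19 19 3, .sub 18 18 3])]

/-- Add one summand of the test statistic to register `18` and go to the next point. -/
def trialStep : Prog :=
  seqs [.query 20 2, .load 21 6, .load 21 21, .fmul 20 20 21, .fadd 18 18 20, incr,
    .sub 19 19 3]

/-- Compute the test statistic for random vectors, and set register `17` if it is nonzero. -/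
def trial : Prog :=
  seqs [fill, clear, .const 18 0, .copy 19 10, .loop 19 trialStep,
    .cond 18 (.const 17 1) .skip]

/-- The `k` vectors of length `n` read from the random sequence at position `q`. -/
def draw {p : ℕ} (k n q : ℕ) (ω : ℕ → ZMod p) (a : Fin k) (b : Fin n) : ZMod p :=
  ω (q + (a * n + b))

theorem run_fill {k : ℕ} {s : State} (hs : Consts p n k s) :
    Run f ω fill s (6 * (k * n) + 4) fun s' => Agree 18 s s' ∧ s'.pos = s.pos + k * n ∧
      (∀ a < p + n + k, s'.mem a = s.mem a) ∧
      ∀ c < k * n, s'.mem (p + n + k + c) = (ω (s.pos + c)).val := by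
  refine Run.mono (B := 1 + (k * n * (5 + 1) + 1) + 1 + 1) (.seqs_cons <| .copy <| .seqs_cons <|
    .copy <| .seqs_cons <| .loop (fun i s' => Agree 18 s s' ∧ s'.pos = s.pos + i ∧
      s'.reg 18 = k * n - i ∧ s'.reg 19 = p + n + k + i ∧
      (∀ a < p + n + k, s'.mem a = s.mem a) ∧
      ∀ c < i, s'.mem (p + n + k + c) = (ω (s.pos + c)).val) (k * n)
      ?_ ?_ ?_) (by omega) fun _ h => h
  · exact ⟨((Agree.refl _ _).setReg (by omega) _).setReg (by omega) _, rfl, by simp [hs.r9],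
      by simp [hs.r7], fun _ _ => rfl, by simp⟩
  · rintro i hi s' ⟨hA, hpos, h18, h19, hm, hv⟩
    have hs' := hs.of_agree hA (by omega)
    refine ⟨by omega, .seqs_cons <| .rand <| .seqs_cons <| .store <| .seqs_cons <| .add <|
      .seqs_cons <| .sub <| .seqs_nil ⟨?_, ?_, ?_, ?_, fun a ha => ?_, fun c hc => ?_⟩⟩
    · exact ((hA.setReg (by omega) _).setReg (by omega) _).setReg (by omega) _
    · simp [hpos]; ring
    · simp [h18, hs'.r3]; omega
    · simp [h19, hs'.r3]; ring
    · have : a ≠ p + n + k + i := by omega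
      simp [h19, this, hm a ha]
    · by_cases hci : c = i
      · subst hci
        simp [h19, hpos]
      · simp [h19, hci, hv c (by omega)]
  · rintro s' ⟨hA, hpos, h18, h19, hm, hv⟩
    exact ⟨by omega, .seqs_nil ⟨hA, hpos, hm, hv⟩⟩

theorem run_clear {k : ℕ} {s : State} (hs : Consts p n k s) :
    Run f ω clear s (5 * (n + k) + 5) fun s' => Agree 18 s s' ∧ s'.pos = s.pos ∧
      (∀ a, a < p ∨ p + n + k ≤ a → s'.mem a = s.mem a) ∧
      ∀ c < n + k, s'.mem (p + c) = 0 := by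
  refine Run.mono (B := 1 + ((n + k) * (4 + 1) + 1) + 1 + 1 + 1) (.seqs_cons <| .copy <|
    .seqs_cons <| .copy <| .seqs_cons <| .const <| .seqs_cons <|
    .loop (fun i s' => Agree 18 s s' ∧ s'.pos = s.pos ∧
      s'.reg 18 = n + k - i ∧ s'.reg 19 = p + i ∧ s'.reg 20 = 0 ∧
      (∀ a, a < p ∨ p + n + k ≤ a → s'.mem a = s.mem a) ∧
      ∀ c < i, s'.mem (p + c) = 0) (n + k)
      ?_ ?_ ?_) (by omega) fun _ h => h
  · exact ⟨(((Agree.refl _ _).setReg (by omega) _).setReg (by omega) _).setReg (by omega) _, rfl,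
      by simp [hs.r8], by simp [hs.r2], by simp, fun _ _ => rfl, by simp⟩
  · rintro i hi s' ⟨hA, hpos, h18, h19, h20, hm, hv⟩
    have hs' := hs.of_agree hA (by omega)
    refine ⟨by omega, .seqs_cons <| .store <| .seqs_cons <| .add <|
      .seqs_cons <| .sub <| .seqs_nil ⟨?_, hpos, ?_, ?_, ?_, fun a ha => ?_, fun c hc => ?_⟩⟩
    · exact ((hA.setMem _ _).setReg (by omega) _).setReg (by omega) _
    · simp [h18, hs'.r3]; omega
    · simp [h19, hs'.r3]; ring
    · simpa using h20
    · have : a ≠ p + i := by omega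
      simp [h19, this, hm a ha]
    · by_cases hci : c = i
      · subst hci
        simp [h19, h20]
      · simp [h19, hci, hv c (by omega)]
  · rintro s' ⟨hA, hpos, h18, h19, h20, hm, hv⟩
    exact ⟨by omega, .seqs_nil ⟨hA, hpos, hm, hv⟩⟩

end

variable {p n : ℕ} [hp : Fact p.Prime] {f : (Fin n → ZMod p) → ZMod p} {ω : ℕ → ZMod p}

/-- The digits of `m < p ^ k` in base `p` run through all of `F_p^k`. -/
theorem testSum_eq_sum_range {k : ℕ} [NeZero k] (e : ℕ) (V : Fin k → Fin n → ZMod p) :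
    testSum e f V = ∑ m ∈ range (p ^ k),
      (m : ZMod p) ^ e * f (∑ a : Fin k, ((m / p ^ (a : ℕ) : ℕ) : ZMod p) • V a) := by
  rw [sum_range, testSum]
  symm
  refine Fintype.sum_bijective
    (fun (m : Fin (p ^ k)) (a : Fin k) => ((m / p ^ (a : ℕ) : ℕ) : ZMod p)) ?_ _ _ fun m => ?_
  · rw [Fintype.bijective_iff_injective_and_card]
    refine ⟨fun m m' h => ?_, by simp [ZMod.card]⟩
    refine finFunctionFinEquiv.symm.injective (funext fun a => Fin.ext ?_)
    have := congrFun h a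
    rw [ZMod.natCast_eq_natCast_iff'] at this
    simpa using this
  · simp

/-- One round of the enumeration; the register that holds the partial sum is described by its
residue and by being less than `p`, which makes the final zero test exact. -/
theorem run_trialStep {k e m : ℕ} [NeZero k] {V : Fin k → Fin n → ZMod p} {s : State}
    (hs : Consts p n k s) (hC : Config V e (fun _ => m) s.mem) :
    Run f ω trialStep s (k * (10 * n + 15) + 13) fun s' => Agree 18 s s' ∧ s'.pos = s.pos ∧
      Config V e (fun _ => m + 1) s'.mem ∧ s'.reg 19 = s.reg 19 - 1 ∧ s'.reg 18 < p ∧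
      (s'.reg 18 : ZMod p) = s.reg 18 +
        (m : ZMod p) ^ e * f (∑ a : Fin k, ((m / p ^ (a : ℕ) : ℕ) : ZMod p) • V a) := by
  have hp0 := hp.out.pos
  have hpt : (fun i : Fin n => (s.mem (s.reg 2 + i) : ZMod p)) =
      ∑ a : Fin k, ((m / p ^ (a : ℕ) : ℕ) : ZMod p) • V a := by
    funext b
    rw [hs.r2, hC.point b]
    simp
  have hw : (s.mem (s.mem (s.reg 6)) : ZMod p) = (m : ZMod p) ^ e := by
    have := hC.digit 0 (Nat.pos_of_ne_zero (NeZero.ne k))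
    rw [add_zero, pow_zero, Nat.div_one] at this
    rw [hs.r6, this, hC.table _ (Nat.mod_lt _ hp0), ZMod.natCast_mod]
  refine Run.mono (B := 1 + 1 + (k * (10 * n + 15) + 6) + 1 + 1 + 1 + 1 + 1) (.seqs_cons <|
    .query <| .seqs_cons <| .load <| .seqs_cons <| .load <| .seqs_cons <| .fmul <| .seqs_cons <|
    .fadd <| .seqs_cons ?_) (by omega) fun _ h => h
  rw [hpt]
  set st := State.setReg _ 18 _ with hst
  have hA : Agree 18 s st := ((((((Agree.refl _ _).setReg (by omega) _).setReg (by omega) _).setReg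
    (by omega) _).setReg (by omega) _)).setReg (by omega) _
  have h18 : st.reg 18 < p := by
    simp only [hst, State.reg_setReg, if_true]
    exact Nat.mod_lt _ hp0
  have h18' : (st.reg 18 : ZMod p) = s.reg 18 +
      (m : ZMod p) ^ e * f (∑ a : Fin k, ((m / p ^ (a : ℕ) : ℕ) : ZMod p) • V a) := by
    simp [hst, hw, mul_comm]
  have h19 : st.reg 19 = s.reg 19 := by simp [hst]
  have hmem : st.mem = s.mem := rfl
  have hpos : st.pos = s.pos := rfl
  clear_value st
  refine (run_incr (hs.of_agree hA (by omega)) (hmem ▸ hC)).mono le_rfl ?_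
  rintro s₁ ⟨hA₁, hpos₁, hC₁⟩
  have hs₁ := (hs.of_agree hA (by omega)).of_agree hA₁ (by omega)
  have g18 := hA₁ 18 (by omega)
  refine .seqs_cons <| .sub <| .seqs_nil ⟨(hA.trans hA₁ (by omega)).setReg (by omega) _,
    hpos₁.trans hpos, hC₁, ?_, ?_, ?_⟩
  · simp [hA₁ 19 (by omega), h19, hs₁.r3]
  · simpa [g18] using h18
  · simp [g18, h18']

/-- A bound for the number of steps of one trial. -/
def trialTime (p n k : ℕ) : ℕ :=
  p ^ k * (k * (10 * n + 15) + 14) + 6 * (k * n) + 5 * (n + k) + 15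

theorem run_trial {k e : ℕ} [NeZero k] {s : State} (hs : Consts p n k s)
    (ht : Table p e s.mem) :
    Run f ω trial s (trialTime p n k) fun s' => Agree 17 s s' ∧ s'.pos = s.pos + k * n ∧
      Table p e s'.mem ∧
      (s'.reg 17 ≠ 0 ↔ s.reg 17 ≠ 0 ∨ testSum e f (draw k n s.pos ω) ≠ 0) := by
  set V := draw k n s.pos ω with hV
  refine Run.mono (B := 1 + (1 + 1) + (p ^ k * (k * (10 * n + 15) + 13 + 1) + 1) + 1 + 1 +
    (5 * (n + k) + 5) + (6 * (k * n) + 4)) (.seqs_cons <| (run_fill hs).mono le_rfl ?_)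
    (by
      rw [trialTime, show k * (10 * n + 15) + 14 = k * (10 * n + 15) + 13 + 1 from rfl]; omega) fun _ h => h
  rintro s₁ ⟨hA₁, hpos₁, hm₁, hv₁⟩
  have hs₁ := hs.of_agree hA₁ (by omega)
  refine .seqs_cons <| (run_clear hs₁).mono le_rfl ?_
  rintro s₂ ⟨hA₂, hpos₂, hm₂, hz₂⟩
  have hs₂ := hs₁.of_agree hA₂ (by omega)
  have hC : Config V e (fun _ => 0) s₂.mem :=
    { table := fun a ha => by rw [hm₂ a (by omega), hm₁ a (by omega), ht a ha]
      point := fun b => by rw [hz₂ b (by omega)]; simp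
      digit := fun i hi => by rw [add_assoc, hz₂ _ (by omega)]; simp
      vec := fun a b => by
        have hlt : (a : ℕ) * n + b < k * n := by
          have : ((a : ℕ) + 1) * n ≤ k * n := Nat.mul_le_mul_right _ a.2
          have := b.2
          rw [add_mul] at *
          omega
        rw [hm₂ _ (by omega), add_assoc (p + n + k), hv₁ _ hlt, ZMod.natCast_zmod_val]
        rfl }
  have hA : Agree 18 s s₂ := hA₁.trans hA₂ le_rfl
  refine .seqs_cons <| .const <| .seqs_cons <| .copy <| .seqs_cons <| .loop (fun m s' =>
    Agree 18 s s' ∧ s'.pos = s.pos + k * n ∧ Config V e (fun _ => m) s'.mem ∧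
    s'.reg 19 = p ^ k - m ∧ s'.reg 18 < p ∧ (s'.reg 18 : ZMod p) = ∑ m ∈ range m,
      (m : ZMod p) ^ e * f (∑ a : Fin k, ((m / p ^ (a : ℕ) : ℕ) : ZMod p) • V a)) (p ^ k)
    ?_ ?_ ?_
  · refine ⟨(hA.setReg (by omega) _).setReg (by omega) _, hpos₂.trans hpos₁, hC,
      by simp [hs₂.r10], ?_, ?_⟩
    · simpa using hp.out.pos
    · simp
  · rintro m hm s' ⟨hA', hpos', hC', h19, h18, hS⟩
    refine ⟨by omega, (run_trialStep (hs.of_agree hA' (by omega)) hC').mono le_rfl ?_⟩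
    rintro s'' ⟨hA'', hpos'', hC'', h19', h18', hS'⟩
    exact ⟨hA'.trans hA'' le_rfl, hpos''.trans hpos', hC'', by omega, h18', by
      rw [hS', hS, sum_range_succ]⟩
  · rintro s' ⟨hA', hpos', hC', h19, h18, hS⟩
    rw [← testSum_eq_sum_range] at hS
    have hiff : s'.reg 18 ≠ 0 ↔ testSum e f V ≠ 0 := by
      rw [← hS, Ne, Ne, ZMod.natCast_eq_zero_iff]
      refine not_congr ⟨fun h => h ▸ dvd_zero _, fun h => Nat.eq_zero_of_dvd_of_lt h h18⟩
    have h17 := hA' 17 (by omega)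
    refine ⟨by omega, .seqs_cons <| .cond (fun h => .const <| .seqs_nil ?_)
      fun h => .skip <| .seqs_nil ?_⟩
    · refine ⟨Agree.setReg (fun y hy => hA' y (by omega)) le_rfl _, hpos', hC'.table, ?_⟩
      simp [hiff.1 h]
    · refine ⟨fun y hy => hA' y (by omega), hpos', hC'.table, ?_⟩
      rw [h17, ← hiff]
      simp [h]

end LowDegree

/-! ### The algorithm -/

namespace LowDegree
open Finset

/-- Store the weights `a ^ e` for `a < p` in the memory cells below `p`. -/
def storeWeights : Prog :=
  seqs [.const 13 0, .copy 12 2, .loop 12 (seqs [.const 14 1, .copy 15 5,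
    .loop 15 (seqs [.fmul 14 14 13, .sub 15 15 3]), .store 13 14, .add 13 13 3, .sub 12 12 3])]

/-- Compute the fixed registers, the number `10 * p * n ^ 12` of trials (register `11`), and the
weights. The registers `12` to `15` are auxiliary. -/
def setup : Prog :=
  seqs [.add 6 2 0, .add 7 6 4, .add 8 0 4, mulTo 9 0 4 12, .const 10 1, .copy 12 4,
    powTo 10 2 12 13 14, .const 12 10, mulTo 11 2 12 13, .const 12 12, powTo 11 0 12 13 14,
    storeWeights]

/-- The algorithm. The first loop computes `k = ⌈d / (p - 1)⌉` and `e = k * (p - 1) - d`. If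
`k > n` it rejects, otherwise it accepts if the test statistic is nonzero in some trial. -/
def tester : Prog :=
  seqs [.const 3 1, .sub 6 2 3, .copy 7 1, .const 4 0, .const 5 0,
    .loop 7 (seqs [.add 4 4 3, .sub 5 6 7, .sub 7 7 6]), .sub 8 4 0,
    .cond 8 (.const 0 0) (seqs [setup, .const 17 0, .copy 16 11,
      .loop 16 (seqs [trial, .sub 16 16 3]), .copy 0 17])]

variable {p n : ℕ} {f : (Fin n → ZMod p) → ZMod p} {ω : ℕ → ZMod p}

theorem run_storeWeights {e : ℕ} {s : State} (h2 : s.reg 2 = p) (h3 : s.reg 3 = 1)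
    (h5 : s.reg 5 = e) :
    Run f ω storeWeights s (p * (4 * e + 8) + 4) fun s' => Agree 12 s s' ∧ s'.pos = s.pos ∧
      Table p e s'.mem := by
  refine Run.mono (B := 1 + (p * ((1 + 1 + 1 + 1 + (e * (3 + 1) + 1) + 1 + 1) + 1) + 1) + 1 + 1)
    (.seqs_cons <| .const <| .seqs_cons <| .copy <| .seqs_cons <| .loop (fun i s' => Agree 12 s s' ∧
      s'.pos = s.pos ∧ s'.reg 12 = p - i ∧ s'.reg 13 = i ∧
      ∀ a < i, (s'.mem a : ZMod p) = (a : ZMod p) ^ e) p ?_ ?_ ?_) (by ring_nf; omega) fun _ h => h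
  · exact ⟨((Agree.refl _ _).setReg (by omega) _).setReg (by omega) _, rfl, by simp [h2],
      by simp, by simp⟩
  · rintro i hi s' ⟨hA, hpos, h12, h13, hw⟩
    refine ⟨by omega, .seqs_cons <| .const <| .seqs_cons <| .copy <| .seqs_cons <|
      .loop (fun j s'' => Agree 14 s' s'' ∧ s''.pos = s'.pos ∧ s''.mem = s'.mem ∧
        s''.reg 15 = e - j ∧ (s''.reg 14 : ZMod p) = (i : ZMod p) ^ j) e ?_ ?_ ?_⟩
    · exact ⟨((Agree.refl _ _).setReg (by omega) _).setReg (by omega) _, rfl, rfl,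
        by simp [hA 5 (by omega), h5], by simp⟩
    · rintro j hj s'' ⟨hA', hpos', hm', h15, h14⟩
      have h3' := (hA' 3 (by omega)).trans ((hA 3 (by omega)).trans h3)
      have h13' := (hA' 13 (by omega)).trans h13
      refine ⟨by omega, .seqs_cons <| .fmul <| .seqs_cons <| .sub <| .seqs_nil
        ⟨(hA'.setReg (by omega) _).setReg (by omega) _, hpos', hm', ?_, ?_⟩⟩
      · simp [h15, h3']; omega
      · simp [h14, h13', pow_succ]
    · rintro s'' ⟨hA', hpos', hm', h15, h14⟩
      have h3' := (hA' 3 (by omega)).trans ((hA 3 (by omega)).trans h3)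
      have h13' := (hA' 13 (by omega)).trans h13
      have h12' := (hA' 12 (by omega)).trans h12
      refine ⟨by omega, .seqs_cons <| .store <| .seqs_cons <| .add <| .seqs_cons <| .sub <|
        .seqs_nil ⟨?_, hpos'.trans hpos, ?_, ?_, fun a ha => ?_⟩⟩
      · exact (((hA.trans hA' (by omega)).setMem _ _).setReg (by omega) _).setReg (by omega) _
      · simp [h12', h3']; omega
      · simp [h13', h3']
      · by_cases hai : a = i
        · subst hai
          simp [h13', h14]
        · simp [h13', hai, hm', hw a (by omega)]
  · rintro s' ⟨hA, hpos, h12, h13, hw⟩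
    exact ⟨by omega, .seqs_nil ⟨hA, hpos, hw⟩⟩

/-- A bound for the number of steps of the preparation. -/
def setupTime (p n k e : ℕ) : ℕ :=
  k * (4 * p + 12) + 48 * n + p * (4 * e + 8) + 158

theorem run_setup {k e : ℕ} {s : State} (h0 : s.reg 0 = n) (h2 : s.reg 2 = p) (h3 : s.reg 3 = 1)
    (h4 : s.reg 4 = k) (h5 : s.reg 5 = e) :
    Run f ω setup s (setupTime p n k e) fun s' => Consts p n k s' ∧ s'.pos = s.pos ∧
      Table p e s'.mem ∧ s'.reg 11 = 10 * p * n ^ 12 := by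
  refine Run.mono (B := 1 + (p * (4 * e + 8) + 4) + (12 * (4 * n + 8) + 1) + 1 + (4 * 10 + 4) + 1 +
    (k * (4 * p + 8) + 1) + 1 + 1 + (4 * k + 4) + 1 + 1 + 1) (.seqs_cons <| .add <| .seqs_cons <|
    .add <| .seqs_cons <| .add <| .seqs_cons <| (run_mulTo ?_ ?_ ?_ ?_ ?_ ?_ ?_).mono ?_ ?_)
    (by rw [setupTime]; ring_nf; omega) fun _ h => h
  any_goals decide
  · simp [h3]
  · simp [h4]
  rintro s₁ ⟨hr₁, h9₁, -, hp₁⟩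
  have g0 : s₁.reg 0 = n := by rw [hr₁ _ (by decide) (by decide)]; simp [h0]
  have g2 : s₁.reg 2 = p := by rw [hr₁ _ (by decide) (by decide)]; simp [h2]
  have g3 : s₁.reg 3 = 1 := by rw [hr₁ _ (by decide) (by decide)]; simp [h3]
  have g4 : s₁.reg 4 = k := by rw [hr₁ _ (by decide) (by decide)]; simp [h4]
  have g5 : s₁.reg 5 = e := by rw [hr₁ _ (by decide) (by decide)]; simp [h5]
  have g6 : s₁.reg 6 = p + n := by rw [hr₁ _ (by decide) (by decide)]; simp [h2, h0]
  have g7 : s₁.reg 7 = p + n + k := by rw [hr₁ _ (by decide) (by decide)]; simp [h2, h0, h4]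
  have g8 : s₁.reg 8 = n + k := by rw [hr₁ _ (by decide) (by decide)]; simp [h0, h4]
  have g9 : s₁.reg 9 = k * n := by rw [h9₁]; simp [h0, h4, mul_comm]
  replace hp₁ : s₁.pos = s.pos := hp₁
  clear hr₁ h9₁
  refine .seqs_cons <| .const <| .seqs_cons <| .copy <| .seqs_cons <|
    (run_powTo ?_ ?_ ?_ ?_ ?_ ?_ ?_ ?_ ?_ ?_ ?_ ?_ ?_ ?_ ?_).mono ?_ ?_
  any_goals decide
  · simp [g3]
  · simp [g4, g2]
  rintro s₂ ⟨hr₂, h10₂, -, hp₂⟩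
  have hA₂ : Agree 10 s₁ s₂ := fun y hy => by
    rw [hr₂ y (by omega) (by omega) (by omega) (by omega)]
    simp [show y ≠ 12 by omega, show y ≠ 10 by omega]
  have g10 : s₂.reg 10 = p ^ k := by rw [h10₂]; simp [g2, g4]
  replace hp₂ : s₂.pos = s₁.pos := hp₂
  clear hr₂ h10₂
  refine .seqs_cons <| .const <| .seqs_cons <| (run_mulTo ?_ ?_ ?_ ?_ ?_ ?_ ?_).mono ?_ ?_
  any_goals decide
  · simp [hA₂ 3 (by omega), g3]
  · simp
  rintro s₃ ⟨hr₃, h11₃, -, hp₃⟩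
  have hA₃ : Agree 11 s₂ s₃ := fun y hy => by
    rw [hr₃ y (by omega) (by omega)]
    simp [show y ≠ 12 by omega]
  have g11 : s₃.reg 11 = p * 10 := by rw [h11₃]; simp [hA₂ 2 (by omega), g2]
  replace hp₃ : s₃.pos = s₂.pos := hp₃
  have hA₁₃ := hA₂.trans hA₃ (by omega)
  refine .seqs_cons <| .const <| .seqs_cons <|
    (run_powTo ?_ ?_ ?_ ?_ ?_ ?_ ?_ ?_ ?_ ?_ ?_ ?_ ?_ ?_ ?_).mono ?_ ?_
  any_goals decide
  · simp [hA₁₃ 3 (by omega), g3]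
  · simp [hA₁₃ 0 (by omega), g0]
  rintro s₄ ⟨hr₄, h11₄, -, hp₄⟩
  have hA₄ : Agree 11 s₃ s₄ := fun y hy => by
    rw [hr₄ y (by omega) (by omega) (by omega) (by omega)]
    simp [show y ≠ 12 by omega]
  have g11' : s₄.reg 11 = 10 * p * n ^ 12 := by
    rw [h11₄, show (s₃.setReg 12 12).reg 11 = p * 10 by simp [g11],
      show (s₃.setReg 12 12).reg 0 = n by simp [hA₁₃ 0 (by omega), g0],
      show (s₃.setReg 12 12).reg 12 = 12 by simp]
    ring
  replace hp₄ : s₄.pos = s₃.pos := hp₄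
  have hA₁₄ := hA₁₃.trans hA₄ (by omega)
  refine .seqs_cons <| (run_storeWeights (e := e) ?_ ?_ ?_).mono le_rfl ?_
  · rw [hA₁₄ 2 (by omega), g2]
  · rw [hA₁₄ 3 (by omega), g3]
  · rw [hA₁₄ 5 (by omega), g5]
  rintro s₅ ⟨hA₅, hp₅, ht⟩
  have hA := hA₁₄.trans hA₅ (by omega)
  refine .seqs_nil ⟨⟨?_, ?_, ?_, ?_, ?_, ?_, ?_, ?_, ?_⟩, ?_, ht, ?_⟩
  · rw [hA 0 (by omega), g0]
  · rw [hA 2 (by omega), g2]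
  · rw [hA 3 (by omega), g3]
  · rw [hA 4 (by omega), g4]
  · rw [hA 6 (by omega), g6]
  · rw [hA 7 (by omega), g7]
  · rw [hA 8 (by omega), g8]
  · rw [hA 9 (by omega), g9]
  · rw [hA₅ 10 (by omega), hA₄ 10 (by omega), hA₃ 10 (by omega), g10]
  · rw [hp₅, hp₄, hp₃, hp₂, hp₁]
  · rw [hA₅ 11 (by omega), g11']

/-- A bound for the number of steps of the algorithm. -/
def testerTime (p n k e : ℕ) : ℕ :=
  5 * k + 11 + if k ≤ n then setupTime p n k e + 10 * p * n ^ 12 * (trialTime p n k + 3) + 5 else 1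

/-- Trial `i` uses the random elements from position `i * (k * n)` on, so different trials are
independent. -/
theorem run_tester [hp : Fact p.Prime] {k d e : ℕ} [NeZero k] (hed : e + d = k * (p - 1))
    (he : e < p - 1) :
    Run f ω tester (start p n d) (testerTime p n k e) fun s' => s'.reg 0 ≠ 0 ↔
      k ≤ n ∧ ∃ i < 10 * p * n ^ 12, testSum e f (draw k n (i * (k * n)) ω) ≠ 0 := by
  -- after `i` rounds register `4` holds `i` and register `7` what is left of `d`; in the round that
  -- exhausts `d` the truncated subtraction leaves `e` in register `5`
  refine Run.mono (B := 1 + ((if k ≤ n then setupTime p n k e +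
    10 * p * n ^ 12 * (trialTime p n k + 3) + 5 else 1) + 1) + 1 + (k * (4 + 1) + 1) + 1 + 1 + 1 +
    1 + 1) (.seqs_cons <| .const <| .seqs_cons <| .sub <| .seqs_cons <| .copy <| .seqs_cons <|
    .const <| .seqs_cons <| .const <| .seqs_cons <| .loop (fun i s' => s'.reg 0 = n ∧
      s'.reg 2 = p ∧ s'.reg 3 = 1 ∧ s'.reg 4 = i ∧ s'.reg 5 = i * (p - 1) - d ∧
      s'.reg 6 = p - 1 ∧ s'.reg 7 = d - i * (p - 1) ∧ s'.pos = 0) k ?_ ?_ ?_)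
    (by rw [testerTime]; omega) fun _ h => h
  · simp [start]
  · rintro i hi s ⟨h0, h2, h3, h4, h5, h6, h7, hpos⟩
    have h1 : (i + 1) * (p - 1) ≤ k * (p - 1) := Nat.mul_le_mul_right _ hi
    rw [add_mul, one_mul] at h1
    refine ⟨by omega, .seqs_cons <| .add <| .seqs_cons <| .sub <| .seqs_cons <| .sub <|
      .seqs_nil ⟨?_, ?_, ?_, ?_, ?_, ?_, ?_, hpos⟩⟩ <;>
    simp only [State.reg_setReg, add_mul, one_mul] <;> simp [h0, h2, h3, h4, h6, h7] <;> omega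
  · rintro s ⟨h0, h2, h3, h4, h5, h6, h7, hpos⟩
    refine ⟨by omega, .seqs_cons <| .sub <| .seqs_cons <| .cond (fun h => ?_) fun h => ?_⟩
    · have hkn : ¬ k ≤ n := by
        simp [h4, h0] at h; omega
      rw [if_neg hkn]
      exact .const <| .seqs_nil <| by simp [hkn]
    · have hkn : k ≤ n := by
        simp [h4, h0] at h; omega
      rw [if_pos hkn]
      refine Run.mono (B := 1 + 1 + (10 * p * n ^ 12 * ((1 + 1 + trialTime p n k) + 1) + 1) + 1 +
        1 + setupTime p n k e) (.seqs_cons <|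
        (run_setup (n := n) (k := k) (e := e) ?_ ?_ ?_ ?_ ?_).mono le_rfl ?_) ?_ fun _ h => h
      · simp [h0]
      · simp [h2]
      · simp [h3]
      · simp [h4]
      · simp [h5]; omega
      · rintro s₁ ⟨hC, hpos₁, hT, h11⟩
        refine .seqs_cons <| .const <| .seqs_cons <| .copy <| .seqs_cons <| .loop (fun i s' =>
          Consts p n k s' ∧ Table p e s'.mem ∧ s'.pos = i * (k * n) ∧
          s'.reg 16 = 10 * p * n ^ 12 - i ∧ (s'.reg 17 ≠ 0 ↔
            ∃ j < i, testSum e f (draw k n (j * (k * n)) ω) ≠ 0)) (10 * p * n ^ 12) ?_ ?_ ?_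
        · refine ⟨hC.of_agree (((Agree.refl 11 _).setReg (by omega) _).setReg (by omega) _) le_rfl,
            hT, ?_, by simp [h11], by simp⟩
          simp only [State.pos_setReg, hpos₁, zero_mul]
          exact hpos
        · rintro i hi s' ⟨hC', hT', hpos', h16, h17⟩
          refine ⟨by omega, .seqs_cons <| (run_trial hC' hT').mono le_rfl ?_⟩
          rintro s'' ⟨hA, hpos'', hT'', h17'⟩
          have hC'' := hC'.of_agree hA (by omega)
          refine .seqs_cons <| .sub <| .seqs_nil ⟨hC''.of_agree ((Agree.refl 11 _).setReg (by omega)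
            _) le_rfl, hT'', ?_, ?_, ?_⟩
          · simp only [State.pos_setReg, hpos'', hpos']; ring
          · simp [hA 16 (by omega), h16, hC''.r3]; omega
          · simp only [State.reg_setReg, show (17 : ℕ) ≠ 16 by decide, if_false]
            rw [h17', h17, hpos', Nat.exists_lt_succ_right]
        · rintro s' ⟨hC', hT', hpos', h16, h17⟩
          refine ⟨by omega, .seqs_cons <| .copy <| .seqs_nil <| .seqs_nil ?_⟩
          simp only [State.reg_setReg, if_true, hkn, true_and]
          exact h17
      · rw [show 1 + 1 + trialTime p n k + 1 = trialTime p n k + 3 by ring]; omega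

theorem trialTime_add_le {k : ℕ} (hn : 1 ≤ n) (hp : 1 ≤ p) (hkn : k ≤ n) :
    trialTime p n k + 3 ≤ 73 * (n ^ 2 * p ^ k) := by
  have hP : 1 ≤ p ^ k := Nat.one_le_pow _ _ hp
  have h1 : n ≤ n ^ 2 := Nat.le_self_pow (by omega) n
  have h2 : k * n ≤ n ^ 2 := by rw [sq]; exact Nat.mul_le_mul_right _ hkn
  have h3 : k * (10 * n + 15) + 14 ≤ 39 * n ^ 2 := by
    have : k * (10 * n + 15) = 10 * (k * n) + 15 * k := by ring
    omega
  have h4 : p ^ k * (k * (10 * n + 15) + 14) ≤ 39 * (n ^ 2 * p ^ k) := by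
    calc _ ≤ p ^ k * (39 * n ^ 2) := Nat.mul_le_mul_left _ h3
      _ = _ := by ring
  have h5 : n ^ 2 ≤ n ^ 2 * p ^ k := Nat.le_mul_of_pos_right _ hP
  rw [trialTime]
  omega

theorem testerTime_le {k e : ℕ} (hp : 2 ≤ p) (hn : 1 ≤ n) (hk : 1 ≤ k) (he : e < p - 1) :
    testerTime p n k e ≤ 2000 * n ^ 14 * p ^ (k + 1) := by
  have hkP : k ≤ p ^ k := (Nat.lt_pow_self (by omega)).le
  have hT := trialTime_add_le (p := p) (k := k) hn (by omega)
  have hpP : p ≤ p ^ k := Nat.le_self_pow (by omega) p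
  rw [pow_succ p k]
  generalize p ^ k = P at *
  have hX : 1 ≤ P * p := Nat.mul_pos (by omega) (by omega)
  have hn14 : 1 ≤ n ^ 14 := Nat.one_le_pow _ _ hn
  have hkX : k ≤ P * p := hkP.trans (Nat.le_mul_of_pos_right _ (by omega))
  rw [testerTime]
  split_ifs with hkn
  · have hnn : n ≤ n ^ 14 := Nat.le_self_pow (by omega) n
    have h1 : k * p ≤ P * p := Nat.mul_le_mul_right _ hkP
    have h2 : p * e ≤ P * p := by
      rw [mul_comm P]
      exact Nat.mul_le_mul_left _ (by omega)
    have h3 : p ≤ P * p := Nat.le_mul_of_pos_left _ (by omega)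
    have h4 : setupTime p n k e ≤ 234 * (n ^ 14 * (P * p)) := by
      have e1 : setupTime p n k e = 4 * (k * p) + 12 * k + 48 * n + 4 * (p * e) + 8 * p + 158 := by
        rw [setupTime]; ring
      have e2 : P * p ≤ n ^ 14 * (P * p) := Nat.le_mul_of_pos_left _ (by omega)
      have e3 : n ≤ n ^ 14 * (P * p) := hnn.trans (Nat.le_mul_of_pos_right _ (by omega))
      omega
    have h5 : trialTime p n k + 3 ≤ 73 * (n ^ 2 * P) := hT hkn
    have h6 : 10 * p * n ^ 12 * (trialTime p n k + 3) ≤ 730 * (n ^ 14 * (P * p)) := by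
      calc _ ≤ 10 * p * n ^ 12 * (73 * (n ^ 2 * P)) := Nat.mul_le_mul_left _ h5
        _ = _ := by ring
    have e2 : P * p ≤ n ^ 14 * (P * p) := Nat.le_mul_of_pos_left _ (by omega)
    rw [mul_assoc 2000]
    omega
  · have e2 : P * p ≤ n ^ 14 * (P * p) := Nat.le_mul_of_pos_left _ (by omega)
    rw [mul_assoc 2000]
    omega

end LowDegree

/-! ### The tester decides the degree -/

namespace LowDegree

/-- The number `k = ⌈d / (p - 1)⌉` in terms of natural numbers. -/
theorem ceil_spec {p d k : ℕ} (hp : 2 ≤ p) (hd : 1 ≤ d)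
    (hk : k = ⌈(d : ℚ) / ((p : ℚ) - 1)⌉₊) :
    1 ≤ k ∧ d ≤ k * (p - 1) ∧ k * (p - 1) - d < p - 1 := by
  have hN : (0 : ℚ) < (p : ℚ) - 1 := by
    have : (2 : ℚ) ≤ p := by exact_mod_cast hp
    linarith
  have hd' : (0 : ℚ) < d := by exact_mod_cast hd
  have hcast : ((p - 1 : ℕ) : ℚ) = (p : ℚ) - 1 := by rw [Nat.cast_sub (by omega)]; simp
  have hk1 : 1 ≤ k := by
    rw [hk, Nat.one_le_ceil_iff]
    positivity
  have h1 : d ≤ k * (p - 1) := by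
    have := Nat.le_ceil ((d : ℚ) / ((p : ℚ) - 1))
    rw [← hk, div_le_iff₀ hN, ← hcast] at this
    exact_mod_cast this
  have h2 : k * (p - 1) < d + (p - 1) := by
    have := Nat.ceil_lt_add_one (div_pos hd' hN).le
    rw [← hk, ← sub_lt_iff_lt_add, lt_div_iff₀ hN, sub_mul, one_mul, ← hcast,
      sub_lt_iff_lt_add] at this
    exact_mod_cast this
  exact ⟨hk1, h1, by omega⟩

/-- Reshaping a block of `k * n` random elements into `k` vectors of length `n`. -/
theorem ncard_reshape {p n k : ℕ} (Q : (Fin k → Fin n → ZMod p) → Prop) :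
    {x : Fin (k * n) → ZMod p | Q fun a b => x (finProdFinEquiv (a, b))}.ncard =
      {V : Fin k → Fin n → ZMod p | Q V}.ncard := by
  let E : (Fin (k * n) → ZMod p) ≃ (Fin k → Fin n → ZMod p) :=
    (Equiv.arrowCongr finProdFinEquiv.symm (Equiv.refl (ZMod p))).trans (Equiv.curry _ _ _)
  have h : {x : Fin (k * n) → ZMod p | Q fun a b => x (finProdFinEquiv (a, b))} =
      E ⁻¹' {V | Q V} := rfl
  rw [h, ← Set.ncard_image_of_injective _ E.injective, Set.image_preimage_eq _ E.surjective]

theorem draw_eq_block {p n k : ℕ} (i : ℕ) (ω : ℕ → ZMod p) :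
    draw k n (i * (k * n)) ω = fun a b => block (k * n) i ω (finProdFinEquiv (a, b)) := by
  funext a b
  simp only [draw, block, finProdFinEquiv_apply_val]
  congr 1
  ring

theorem prob_mono {p T : ℕ} [NeZero p] {E E' : (ℕ → ZMod p) → Prop} (h : ∀ ω, E ω → E' ω) :
    prob p T E ≤ prob p T E' := by
  rw [prob, prob]
  refine div_le_div_of_nonneg_right ?_ (by positivity)
  exact_mod_cast Finset.card_le_card fun r hr => by
    simp only [Finset.mem_filter] at hr ⊢
    exact ⟨hr.1, h _ hr.2⟩

theorem prob_eq_one {p T : ℕ} [NeZero p] {E : (ℕ → ZMod p) → Prop} (h : ∀ ω, E ω) :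
    prob p T E = 1 := by
  classical
  rw [prob, Finset.filter_true_of_mem fun r _ => h _, Finset.card_univ]
  exact div_self (by positivity)

/-- A function of degree exactly `d = k * (p - 1) - e` has at least `k` variables: a reduced
monomial in `n` variables has degree at most `n * (p - 1)`. -/
theorem le_of_degP_eq {p n d k e : ℕ} [hp : Fact p.Prime] (hed : e + d = k * (p - 1))
    (he : e < p - 1) (hd : 1 ≤ d) {f : (Fin n → ZMod p) → ZMod p} (hf : degP f = d) : k ≤ n := by
  obtain ⟨c, -, -, α, hα, hs, -⟩ := hf ▸ hasTop_degP (hf ▸ hd)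
  have h1 : ∑ i, α i ≤ n * (p - 1) := by
    refine (Finset.sum_le_card_nsmul _ _ (p - 1) fun i _ => ?_).trans_eq (by simp)
    have := mem_box.1 hα i
    omega
  by_contra h
  have h2 : (n + 1) * (p - 1) ≤ k * (p - 1) := Nat.mul_le_mul_right _ (by omega)
  rw [add_mul, one_mul] at h2
  omega

end LowDegree

theorem mainTheorem7 :
    ∃ (A : LowDegree.Prog) (q : Polynomial ℕ),
      ∀ (p n d : ℕ) [Fact p.Prime], 1 ≤ n → 1 ≤ d →
      ∀ (f : (Fin n → ZMod p) → ZMod p) (T : ℕ),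
        T = q.eval n * p ^ (⌈(d : ℚ) / ((p : ℚ) - 1)⌉₊ + 1) →
        (∀ ω : ℕ → ZMod p, LowDegree.HaltsWithin A d f ω T) ∧
        (LowDegree.degP f = d →
          99 / 100 ≤ LowDegree.prob p T (LowDegree.Accepts A d f)) ∧
        (LowDegree.degP f < d →
          LowDegree.prob p T (LowDegree.Rejects A d f) = 1) := by
  refine ⟨LowDegree.tester, Polynomial.C 2000 * Polynomial.X ^ 14, ?_⟩
  intro p n d hp hn hd f T hT
  have hp2 := hp.out.two_le
  obtain ⟨hk1, hdk, he⟩ := LowDegree.ceil_spec hp2 hd rfl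
  generalize ⌈(d : ℚ) / ((p : ℚ) - 1)⌉₊ = k at *
  have : NeZero k := ⟨by omega⟩
  obtain ⟨e, hed⟩ : ∃ e, e + d = k * (p - 1) := ⟨k * (p - 1) - d, by omega⟩
  replace he : e < p - 1 := by omega
  simp only [Polynomial.eval_mul, Polynomial.eval_C, Polynomial.eval_pow, Polynomial.eval_X] at hT
  have hrun := fun ω => LowDegree.run_tester (f := f) (ω := ω) hed he
  refine ⟨fun ω => ?_, fun hf => ?_, fun hf => ?_⟩
  · obtain ⟨t, ht, s, hs, -⟩ := hrun ω
    exact ⟨t, by rw [hT]; exact ht.trans (LowDegree.testerTime_le hp2 hn hk1 he), s, hs⟩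
  · have hkn := LowDegree.le_of_degP_eq hed he hd hf
    have h1 := LowDegree.pow_le_ncard_testSum hed he hf hd
    rw [← LowDegree.ncard_reshape] at h1
    -- the number `10 * p * n ^ 12` of trials is `5 * M`
    have h2 := LowDegree.prob_exists_block_ge (T := T) (M := 2 * p * n ^ 12) _
      (h1.trans (Nat.mul_le_mul_right _ (Nat.mul_le_mul_left _ (Nat.pow_le_pow_left hkn 12)))) ?_
    · refine h2.trans (LowDegree.prob_mono fun ω hω => ?_)
      obtain ⟨t, -, s, hs, hacc⟩ := hrun ω
      refine ⟨t, s, hs, hacc.2 ⟨hkn, ?_⟩⟩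
      obtain ⟨i, hi, hne⟩ := hω
      refine ⟨i, by linarith, ?_⟩
      rw [LowDegree.draw_eq_block]
      exact hne
    · have hpk : p ≤ p ^ (k + 1) := Nat.le_self_pow (by omega) p
      calc 5 * (2 * p * n ^ 12) * (k * n) ≤ 5 * (2 * p * n ^ 12) * (n * n) :=
            Nat.mul_le_mul_left _ (Nat.mul_le_mul_right _ hkn)
        _ = 10 * n ^ 14 * p := by ring
        _ ≤ 2000 * n ^ 14 * p ^ (k + 1) :=
            Nat.mul_le_mul (Nat.mul_le_mul_right _ (by omega)) hpk
        _ = T := hT.symm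
  · refine LowDegree.prob_eq_one fun ω => ?_
    obtain ⟨t, -, s, hs, hacc⟩ := hrun ω
    refine ⟨t, s, hs, ?_⟩
    by_contra h
    obtain ⟨-, i, -, hne⟩ := hacc.1 h
    exact hne (LowDegree.testSum_eq_zero hed hf _)
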